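/- Let $r:\mathbb{R}\to[0,\infty)$ be bounded, measurable and compactly supported with $\int_{\mathbb{R}} r(x)\,dx=1$. Let $a,c\in\ell^\infty(\mathbb{Z})$ be bounded real sequences, and suppose there is $\delta>0$ with $a(n)\ge\delta$ for all $n\in\mathbb{Z}$. Put $M=\sup\{|E| : E\in\operatorname{supp} r\}$, $I_n=[c(n)-M,\,c(n)+M]$, and let $\Omega=\prod_{n\in\mathbb{Z}} I_n$ carry the product probability measure $$d\mu(\omega)=\prod_{n\in\mathbb{Z}} r(\omega_n-c(n))\,d\omega_n .$$ For $\omega\in\Omega$ let $b_\omega(n)=\omega_n$ and let $J_\omega$ be the bounded Jacobi operator on $\ell^2(\mathbb{Z})$ given by $$(J_\omega\phi)(n)=a(n)\phi(n+1)+a(n-1)\phi(n-1)+b_\omega(n)\phi(n).$$ Then there exist constants $C,\gamma\in(0,\infty)$ such that for all $m\in\mathbb{Z}$ $$\int_{\Omega}\Big(\sup_{t\in\mathbb{R}}\big|\langle\delta_m,\,e^{-itJ_\omega}\delta_0\rangle\big|\Big)\,d\mu(\omega)\le C e^{-\gamma|m|},$$ where $(\delta_m)_{m\in\mathbb{Z}}$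 is the standard orthonormal basis of $\ell^2(\mathbb{Z})$. (In particular, the integrand is a measurable function of $\omega$.) -/

import Mathlib

namespace RandomJacobi

noncomputable section

open MeasureTheory Set
open scoped ENNReal

/-- The Hilbert space `ℓ²(ℤ)` of square-summable complex sequences indexed by `ℤ`. -/
abbrev ell2Z : Type := lp (fun _ : ℤ => ℂ) 2

/-- The space `ℓ^∞(ℤ)` of bounded real sequences indexed by `ℤ`. -/
abbrev ellInftyZ : Type := lp (fun _ : ℤ => ℝ) ∞

/-- The standard unit vector `δ_m` of `ℓ²(ℤ)`. -/
def delta (m : ℤ) : ell2Z := lp.single 2 m (1 : ℂ)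

theorem abs_le_norm (a : ellInftyZ) (n : ℤ) : |a n| ≤ ‖a‖ := by
  rw [← Real.norm_eq_abs]
  exact lp.norm_apply_le_norm (by simp) a n

theorem two_toReal_pos : 0 < (2 : ℝ≥0∞).toReal := by norm_num

theorem summable_shift (f : ell2Z) (k : ℤ) :
    Summable fun n => ‖f (n + k)‖ ^ (2 : ℝ≥0∞).toReal :=
  (Equiv.addRight k).summable_iff.2 ((memℓp_gen_iff two_toReal_pos).1 (lp.memℓp f))

/-- The translation operator `(S_k f)(n) = f (n + k)` on `ℓ²(ℤ)`. -/
def shift (k : ℤ) : ell2Z →L[ℂ] ell2Z :=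
  LinearMap.mkContinuous
    { toFun := fun f => ⟨fun n => f (n + k), (memℓp_gen_iff two_toReal_pos).2 (summable_shift f k)⟩
      map_add' := fun f g => by ext n; rfl
      map_smul' := fun z f => by ext n; rfl }
    1 (by
      intro f
      rw [one_mul]
      refine lp.norm_le_of_tsum_le two_toReal_pos (norm_nonneg f) ?_
      rw [lp.norm_rpow_eq_tsum two_toReal_pos f]
      exact ((Equiv.addRight k).tsum_eq fun n => ‖f n‖ ^ (2 : ℝ≥0∞).toReal).le)

theorem mul_rpow_le (a : ellInftyZ) (f : ell2Z) (n : ℤ) :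
    ‖(a n : ℂ) * f n‖ ^ (2 : ℝ≥0∞).toReal
      ≤ ‖a‖ ^ (2 : ℝ≥0∞).toReal * ‖f n‖ ^ (2 : ℝ≥0∞).toReal := by
  rw [← Real.mul_rpow (norm_nonneg _) (norm_nonneg _), norm_mul, Complex.norm_real,
    Real.norm_eq_abs]
  exact Real.rpow_le_rpow (by positivity)
    (mul_le_mul_of_nonneg_right (abs_le_norm a n) (norm_nonneg _)) two_toReal_pos.le

theorem summable_mul (a : ellInftyZ) (f : ell2Z) :
    Summable fun n => ‖(a n : ℂ) * f n‖ ^ (2 : ℝ≥0∞).toReal :=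
  Summable.of_nonneg_of_le (fun n => by positivity) (mul_rpow_le a f)
    (((memℓp_gen_iff two_toReal_pos).1 (lp.memℓp f)).mul_left _)

/-- The multiplication operator `(M_a f)(n) = a(n) f(n)` on `ℓ²(ℤ)`, for a bounded real `a`. -/
def mulOp (a : ellInftyZ) : ell2Z →L[ℂ] ell2Z :=
  LinearMap.mkContinuous
    { toFun := fun f => ⟨fun n => (a n : ℂ) * f n, (memℓp_gen_iff two_toReal_pos).2 (summable_mul a f)⟩
      map_add' := fun f g => by ext n; exact mul_add _ _ _
      map_smul' := fun z f => by ext n; exact mul_left_comm _ _ _ }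
    ‖a‖ (by
      intro f
      refine lp.norm_le_of_tsum_le two_toReal_pos (by positivity) ?_
      rw [Real.mul_rpow (norm_nonneg _) (norm_nonneg _), lp.norm_rpow_eq_tsum two_toReal_pos f,
        ← tsum_mul_left]
      exact Summable.tsum_le_tsum (mul_rpow_le a f) (summable_mul a f)
        (((memℓp_gen_iff two_toReal_pos).1 (lp.memℓp f)).mul_left _))

/-- The Jacobi operator on `ℓ²(ℤ)` with bounded real off-diagonal `a` and diagonal `b`; see
`jacobi_apply` for its action. -/
def jacobi (a b : ellInftyZ) : ell2Z →L[ℂ] ell2Z :=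
  mulOp a ∘L shift 1 + shift (-1) ∘L mulOp a + mulOp b

/-- `(J φ)(n) = a(n) φ(n+1) + a(n-1) φ(n-1) + b(n) φ(n)`. -/
theorem jacobi_apply (a b : ellInftyZ) (φ : ell2Z) (n : ℤ) :
    jacobi a b φ n = a n * φ (n + 1) + a (n - 1) * φ (n - 1) + b n * φ n := rfl

/-- The unitary group `e^{-itJ}`, as a norm-convergent power series of bounded operators. -/
def evolution (J : ell2Z →L[ℂ] ell2Z) (t : ℝ) : ell2Z →L[ℂ] ell2Z :=
  NormedSpace.exp ((-(Complex.I * (t : ℂ))) • J)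

/-- `M = sup {|E| : E ∈ supp r}`. -/
def supportRadius (r : ℝ → ℝ) : ℝ := sSup ((fun E : ℝ => |E|) '' tsupport r)

/-- The interval `I_n = [c(n) - M, c(n) + M]`. -/
abbrev siteInterval (r : ℝ → ℝ) (c : ellInftyZ) (n : ℤ) : Set ℝ :=
  Icc (c n - supportRadius r) (c n + supportRadius r)

/-- The sample space `Ω = ∏_{n ∈ ℤ} I_n`, with the product σ-algebra. -/
abbrev SampleSpace (r : ℝ → ℝ) (c : ellInftyZ) : Type := ∀ n : ℤ, siteInterval r c n

/-- The distribution `r(x - c(n)) dx` on `I_n`. -/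
def siteMeasure (r : ℝ → ℝ) (c : ellInftyZ) (n : ℤ) : Measure (siteInterval r c n) :=
  Measure.comap Subtype.val (volume.withDensity fun x => ENNReal.ofReal (r (x - c n)))

/-- The product measure `dμ(ω) = ∏_{n ∈ ℤ} r(ω_n - c(n)) dω_n` on `Ω`. -/
def sampleMeasure (r : ℝ → ℝ) (c : ellInftyZ) : Measure (SampleSpace r c) :=
  Measure.infinitePi (siteMeasure r c)

theorem abs_le_supportRadius {r : ℝ → ℝ} (hr : HasCompactSupport r) {x : ℝ} (hx : r x ≠ 0) :
    |x| ≤ supportRadius r :=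
  le_csSup (hr.isCompact.image continuous_abs).bddAbove
    (mem_image_of_mem _ (subset_tsupport r hx))

/-- When `r` is a compactly supported probability density, each single-site distribution is a
probability measure, so that `sampleMeasure` is the genuine product measure. -/
theorem isProbabilityMeasure_siteMeasure {r : ℝ → ℝ} (h0 : ∀ x, 0 ≤ r x)
    (hs : HasCompactSupport r) (h1 : ∫ x, r x = 1) (c : ellInftyZ) (n : ℤ) :
    IsProbabilityMeasure (siteMeasure r c n) := by
  have hint : Integrable r := by
    by_contra h
    rw [integral_undef h] at h1
    exact zero_ne_one h1
  constructor
  rw [siteMeasure, comap_subtype_coe_apply measurableSet_Icc, image_univ, Subtype.range_coe,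
    withDensity_apply _ measurableSet_Icc, setLIntegral_eq_of_support_subset]
  · rw [lintegral_sub_right_eq_self (fun x => ENNReal.ofReal (r x)) (c n),
      ← ofReal_integral_eq_lintegral_ofReal hint (Filter.Eventually.of_forall h0), h1,
      ENNReal.ofReal_one]
  · intro x hx
    have hx' : r (x - c n) ≠ 0 := fun h => hx (by simp [h])
    have := abs_le.1 (abs_le_supportRadius hs hx')
    exact ⟨by linarith [this.1], by linarith [this.2]⟩

/-- The random potential `b_ω(n) = ω(n)`, a bounded sequence. -/
def potential (r : ℝ → ℝ) (c : ellInftyZ) (ω : SampleSpace r c) : ellInftyZ :=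
  ⟨fun n => (ω n : ℝ), memℓp_infty ⟨‖c‖ + supportRadius r, by
    rintro _ ⟨n, rfl⟩
    have h := (ω n).2
    have hc := abs_le.1 (abs_le_norm c n)
    simp only [Real.norm_eq_abs]
    exact abs_le.2 ⟨by linarith [h.1, hc.1], by linarith [h.2, hc.2]⟩⟩⟩

/-- The random Jacobi operator `J_ω`, with off-diagonal `a` and diagonal `b_ω`. -/
def randomJacobi (r : ℝ → ℝ) (a c : ellInftyZ) (ω : SampleSpace r c) : ell2Z →L[ℂ] ell2Z :=
  jacobi a (potential r c ω)

/-- `sup_{t ∈ ℝ} |⟨δ_m, e^{-itJ_ω} δ_n⟩|`, as a supremum in `[0, ∞]`. -/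
def maxAmplitude (r : ℝ → ℝ) (a c : ellInftyZ) (m n : ℤ) (ω : SampleSpace r c) : ℝ≥0∞ :=
  ⨆ t : ℝ, ‖inner ℂ (delta m) (evolution (randomJacobi r a c ω) t (delta n))‖ₑ

end

end RandomJacobi

namespace RandomJacobi

noncomputable section

open MeasureTheory Set
open scoped ENNReal

/-! This is the Kunz–Souillard method. On a finite box, |⟨δ_x, e^{-itJ}δ_y⟩| ≤ ∑_k |φ_k(x) φ_k(y)|
for all t at once, since the exponential phases have modulus one. So it suffices to bound the mean
of this eigenfunction correlator uniformly in the box and then let the box grow.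

Centre the box at one of the two sites, p. For an energy E, let u_E solve the eigenvalue equation
away from p with Dirichlet conditions at both ends and u_E(p) = 1. Then E is an eigenvalue exactly
when b(p) takes the value `pivotVal` at E, apart from eigenvectors that vanish at p. The derivative
of `pivotVal` at E_k is 1/φ_k(p)², so the correlator is formally ∫ |u_E(p + m)| δ(pivotVal(E) -
b(p)) dE. The delta function is replaced by narrow bumps, and Fatou's lemma supplies the one
inequality needed (`boxCorrelator_le_liminf`).

For almost every E the integrand is an explicit function of continued fractions in the site
variables. Averaging over b(p) turns the bump into a bounded, square-integrable function. Averaging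
over b(p + 1), …, b(p + m) then applies, one site at a time, a unitary inversion t ↦ a²/t, a
reflection and a convolution with r (`lintegral_partialAvg_update_le`). The mean is thus bounded by
the recursion `ksIter`.

Exponential decay comes from `exists_contraction`: two such steps shrink the L² norm by a factor
below one that depends only on the bounds for r and a. Averaging contracts functions that are
concentrated on some bounded window (`exists_sqNorm_smooth_le`). A function without concentration
loses its mass near 0 when averaged, relative to the original norm; inversion exchanges the
neighbourhoods of 0 and ∞, so the inverted function cannot also be spread out unless norm has
already been lost. No compactness in E is used, so the decay is uniform in energy, and integrating
over an energy window containing all box spectra finishes the proof. -/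

/-! ### Averaging over translations in L². -/

/-- The squared `L²` norm of a nonnegative function on the line. -/
def sqNorm (f : ℝ → ℝ≥0∞) : ℝ≥0∞ := ∫⁻ x, f x ^ 2

/-- The autocorrelation of a nonnegative function on the line. -/
def autocorr (f : ℝ → ℝ≥0∞) (w : ℝ) : ℝ≥0∞ := ∫⁻ x, f (x + w) * f x

/-- The squared `L²` distance between a function and its translate. -/
def displacement (F : ℝ → ℝ) (w : ℝ) : ℝ≥0∞ := ∫⁻ x, ENNReal.ofReal ((F (x + w) - F x) ^ 2)

/-- Averaging of a function over translations distributed with density `ρ`. -/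
def smooth (ρ f : ℝ → ℝ≥0∞) (s : ℝ) : ℝ≥0∞ := ∫⁻ u, ρ u * f (s + u)

theorem sq_lintegral_mul_le {α : Type*} [MeasurableSpace α] {μ : Measure α} {f g : α → ℝ≥0∞}
    (hf : AEMeasurable f μ) (hg : AEMeasurable g μ) :
    (∫⁻ x, f x * g x ∂μ) ^ 2 ≤ (∫⁻ x, f x ^ 2 ∂μ) * ∫⁻ x, g x ^ 2 ∂μ := by
  have h := ENNReal.lintegral_mul_le_Lp_mul_Lq μ Real.HolderConjugate.two_two hf hg
  have e : ∀ z : ℝ≥0∞, (z ^ (1 / 2 : ℝ)) ^ 2 = z := by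
    intro z
    rw [← ENNReal.rpow_natCast, ← ENNReal.rpow_mul]
    norm_num
  calc (∫⁻ x, f x * g x ∂μ) ^ 2
      ≤ ((∫⁻ x, f x ^ (2 : ℝ) ∂μ) ^ (1 / 2 : ℝ) * (∫⁻ x, g x ^ (2 : ℝ) ∂μ) ^ (1 / 2 : ℝ)) ^ 2 :=
        pow_le_pow_left' h 2
    _ = _ := by simp only [mul_pow, e, ENNReal.rpow_two]

/-- Telescope the translation by k·w into k translations by w and apply Cauchy–Schwarz to the sum.
-/
theorem displacement_nat_mul_le {F : ℝ → ℝ} (hF : Measurable F) (w : ℝ) (k : ℕ) :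
    displacement F (k * w) ≤ (k : ℝ≥0∞) ^ 2 * displacement F w := by
  have pt : ∀ x, ENNReal.ofReal ((F (x + k * w) - F x) ^ 2)
      ≤ (k : ℝ≥0∞) * ∑ i ∈ Finset.range k,
        ENNReal.ofReal ((F ((x + i * w) + w) - F (x + i * w)) ^ 2) := by
    intro x
    have h1 : F (x + k * w) - F x
        = ∑ i ∈ Finset.range k, (F ((x + i * w) + w) - F (x + i * w)) := by
      have := Finset.sum_range_sub (fun i : ℕ => F (x + i * w)) k
      simp only [Nat.cast_zero, zero_mul, add_zero] at this
      rw [← this]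
      refine Finset.sum_congr rfl fun i _ => ?_
      congr 2
      push_cast
      ring
    rw [h1, ← ENNReal.ofReal_natCast, ← ENNReal.ofReal_sum_of_nonneg (fun i _ => sq_nonneg _),
      ← ENNReal.ofReal_mul (Nat.cast_nonneg _)]
    refine ENNReal.ofReal_le_ofReal ?_
    simpa using sq_sum_le_card_mul_sum_sq (s := Finset.range k)
      (f := fun i : ℕ => F ((x + i * w) + w) - F (x + i * w))
  calc displacement F (k * w)
      ≤ ∫⁻ x, (k : ℝ≥0∞) * ∑ i ∈ Finset.range k,
        ENNReal.ofReal ((F ((x + i * w) + w) - F (x + i * w)) ^ 2) := lintegral_mono pt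
    _ = (k : ℝ≥0∞) * ∑ i ∈ Finset.range k, displacement F w := by
        rw [lintegral_const_mul _ (by fun_prop), lintegral_finsetSum _ (fun i _ => by fun_prop)]
        congr 1
        refine Finset.sum_congr rfl fun i _ => ?_
        exact lintegral_add_right_eq_self
          (fun x => ENNReal.ofReal ((F (x + w) - F x) ^ 2)) (i * w)
    _ = (k : ℝ≥0∞) ^ 2 * displacement F w := by simp [sq, mul_assoc]

/-- If F barely changes under translation by w, its mass on the window recurs on n translates. These
are disjoint because the window has length 2R < |w|, so n times that mass is controlled by the total
mass plus displacement errors. -/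
theorem nat_mul_lintegral_Icc_le {F : ℝ → ℝ} (hF : Measurable F) {z R w : ℝ}
    (hw : 2 * R < |w|) (n : ℕ) :
    (n : ℝ≥0∞) * ∫⁻ x in Icc (z - R) (z + R), ENNReal.ofReal (F x ^ 2)
      ≤ 2 * (∫⁻ x, ENNReal.ofReal (F x ^ 2)) + 2 * (n : ℝ≥0∞) ^ 3 * displacement F w := by
  set I := Icc (z - R) (z + R)
  have h1 : ∀ k ∈ Finset.range n, ∫⁻ x in I, ENNReal.ofReal (F x ^ 2)
      ≤ 2 * (∫⁻ x in I, ENNReal.ofReal (F (x + k * w) ^ 2))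
        + 2 * ((n : ℝ≥0∞) ^ 2 * displacement F w) := by
    intro k hk
    have hkn : (k : ℝ≥0∞) ≤ n := by exact_mod_cast (Finset.mem_range.1 hk).le
    have pt : ∀ x, ENNReal.ofReal (F x ^ 2) ≤ 2 * ENNReal.ofReal (F (x + k * w) ^ 2)
        + 2 * ENNReal.ofReal ((F (x + k * w) - F x) ^ 2) := by
      intro x
      rw [show (2 : ℝ≥0∞) = ENNReal.ofReal 2 by simp, ← ENNReal.ofReal_mul (by norm_num),
        ← ENNReal.ofReal_mul (by norm_num), ← ENNReal.ofReal_add (by positivity) (by positivity)]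
      refine ENNReal.ofReal_le_ofReal ?_
      nlinarith [sq_nonneg (2 * F (x + k * w) - F x)]
    refine (lintegral_mono pt).trans ?_
    rw [lintegral_add_left (by fun_prop), lintegral_const_mul _ (by fun_prop),
      lintegral_const_mul _ (by fun_prop)]
    gcongr
    calc ∫⁻ x in I, ENNReal.ofReal ((F (x + k * w) - F x) ^ 2)
        ≤ displacement F (k * w) := setLIntegral_le_lintegral _ _
      _ ≤ _ := displacement_nat_mul_le hF w k
      _ ≤ _ := by gcongr
  have h2 : ∀ k : ℕ, ∫⁻ x in I, ENNReal.ofReal (F (x + k * w) ^ 2)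
      = ∫⁻ x in (fun x => x + -(k * w)) ⁻¹' I, ENNReal.ofReal (F x ^ 2) := by
    intro k
    rw [← lintegral_indicator measurableSet_Icc,
      ← lintegral_indicator (measurable_add_const _ measurableSet_Icc),
      ← lintegral_add_right_eq_self (((fun x => x + -(k * w)) ⁻¹' I).indicator
        fun x => ENNReal.ofReal (F x ^ 2)) (k * w)]
    refine lintegral_congr fun x => ?_
    simp only [indicator, mem_preimage, add_neg_cancel_right, I]
  have h3 : ∑ k ∈ Finset.range n, ∫⁻ x in I, ENNReal.ofReal (F (x + k * w) ^ 2)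
      ≤ ∫⁻ x, ENNReal.ofReal (F x ^ 2) := by
    simp only [h2]
    rw [← lintegral_biUnion_finset _ (fun k _ => measurable_add_const _ measurableSet_Icc)]
    · exact setLIntegral_le_lintegral _ _
    · intro k _ l _ hkl
      refine Set.disjoint_left.2 fun x hx hy => ?_
      simp only [mem_preimage, mem_Icc] at hx hy
      have h4 : |(k : ℝ) * w - l * w| ≤ 2 * R := by
        rw [abs_le]; constructor <;> linarith [hx.1, hx.2, hy.1, hy.2]
      rw [← sub_mul, abs_mul] at h4
      have h5 : (1 : ℝ) ≤ |(k : ℝ) - l| := by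
        have : (1 : ℤ) ≤ |(k : ℤ) - l| := Int.one_le_abs (by omega)
        exact_mod_cast this
      nlinarith [abs_nonneg w]
  calc (n : ℝ≥0∞) * ∫⁻ x in I, ENNReal.ofReal (F x ^ 2)
      = ∑ k ∈ Finset.range n, ∫⁻ x in I, ENNReal.ofReal (F x ^ 2) := by simp
    _ ≤ ∑ k ∈ Finset.range n, (2 * (∫⁻ x in I, ENNReal.ofReal (F (x + k * w) ^ 2))
        + 2 * ((n : ℝ≥0∞) ^ 2 * displacement F w)) := Finset.sum_le_sum h1
    _ = 2 * (∑ k ∈ Finset.range n, ∫⁻ x in I, ENNReal.ofReal (F (x + k * w) ^ 2))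
        + 2 * (n : ℝ≥0∞) ^ 3 * displacement F w := by
        rw [Finset.sum_add_distrib, ← Finset.mul_sum]
        simp only [Finset.sum_const, Finset.card_range, nsmul_eq_mul]
        ring
    _ ≤ _ := by gcongr

theorem displacement_add_autocorr {F : ℝ → ℝ} (hF : Measurable F) (hF0 : ∀ x, 0 ≤ F x) (w : ℝ) :
    displacement F w + 2 * autocorr (fun x => ENNReal.ofReal (F x)) w
      = 2 * ∫⁻ x, ENNReal.ofReal (F x ^ 2) := by
  unfold displacement autocorr
  rw [← lintegral_const_mul _ (by fun_prop), ← lintegral_add_left (by fun_prop), two_mul]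
  nth_rw 1 [← lintegral_add_right_eq_self (fun x => ENNReal.ofReal (F x ^ 2)) w]
  rw [← lintegral_add_left (by fun_prop)]
  refine lintegral_congr fun x => ?_
  have := hF0 x
  have := hF0 (x + w)
  rw [show (2 : ℝ≥0∞) = ENNReal.ofReal 2 by simp, ← ENNReal.ofReal_mul (by positivity),
    ← ENNReal.ofReal_mul (by positivity), ← ENNReal.ofReal_add (by positivity) (by positivity),
    ← ENNReal.ofReal_add (by positivity) (by positivity)]
  congr 1
  ring

theorem measurable_smooth {ρ f : ℝ → ℝ≥0∞} (hρ : Measurable ρ) (hf : Measurable f) :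
    Measurable (smooth ρ f) := by
  unfold smooth
  exact Measurable.lintegral_prod_right' (f := fun z : ℝ × ℝ => ρ z.2 * f (z.1 + z.2))
    (by fun_prop)

/-- Jensen's inequality for the probability density ρ, obtained from Cauchy–Schwarz against the
constant 1. -/
theorem smooth_sq_le {ρ f : ℝ → ℝ≥0∞} (hρ : Measurable ρ) (h1 : ∫⁻ u, ρ u = 1)
    (hf : Measurable f) (s : ℝ) : smooth ρ f s ^ 2 ≤ ∫⁻ u, ρ u * f (s + u) ^ 2 := by
  have h := sq_lintegral_mul_le (μ := volume.withDensity ρ) (f := fun _ => (1 : ℝ≥0∞))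
    (g := fun u => f (s + u)) (by fun_prop) (by fun_prop)
  rw [lintegral_withDensity_eq_lintegral_mul _ hρ (by fun_prop),
    lintegral_withDensity_eq_lintegral_mul _ hρ (by fun_prop),
    lintegral_withDensity_eq_lintegral_mul _ hρ (by fun_prop)] at h
  simpa [smooth, h1] using h

theorem setLIntegral_smooth_sq_le {ρ f : ℝ → ℝ≥0∞} (hρ : Measurable ρ) (h1 : ∫⁻ u, ρ u = 1)
    (hf : Measurable f) {S : Set ℝ} {M : ℝ≥0∞}
    (hM : ∀ u, ∫⁻ s in S, f (s + u) ^ 2 ≤ M) : ∫⁻ s in S, smooth ρ f s ^ 2 ≤ M := by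
  calc ∫⁻ s in S, smooth ρ f s ^ 2 ≤ ∫⁻ s in S, ∫⁻ u, ρ u * f (s + u) ^ 2 :=
        lintegral_mono fun s => smooth_sq_le hρ h1 hf s
    _ = ∫⁻ u, ∫⁻ s in S, ρ u * f (s + u) ^ 2 :=
        lintegral_lintegral_swap (Measurable.aemeasurable (by fun_prop))
    _ = ∫⁻ u, ρ u * ∫⁻ s in S, f (s + u) ^ 2 :=
        lintegral_congr fun u => lintegral_const_mul _ (by fun_prop)
    _ ≤ ∫⁻ u, ρ u * M := lintegral_mono fun u => by gcongr; exact hM u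
    _ = M := by rw [lintegral_mul_const _ hρ, h1, one_mul]

theorem sqNorm_smooth_le {ρ f : ℝ → ℝ≥0∞} (hρ : Measurable ρ) (h1 : ∫⁻ u, ρ u = 1)
    (hf : Measurable f) : sqNorm (smooth ρ f) ≤ sqNorm f := by
  have := setLIntegral_smooth_sq_le hρ h1 hf (S := univ) (M := sqNorm f) (fun u => by
    rw [setLIntegral_univ, lintegral_add_right_eq_self (fun s => f s ^ 2) u]; rfl)
  rwa [setLIntegral_univ] at this

/-- Expanding the square and using Fubini makes the norm of an average a mean of autocorrelations
over two independent translations u and v. A loss in the autocorrelation for large |u - v| thus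
becomes a loss of norm. -/
theorem sqNorm_smooth_eq {ρ f : ℝ → ℝ≥0∞} (hρ : Measurable ρ) (hf : Measurable f) :
    sqNorm (smooth ρ f) = ∫⁻ u, ∫⁻ v, ρ u * ρ v * autocorr f (u - v) := by
  have e : ∀ s, smooth ρ f s ^ 2 = ∫⁻ u, ∫⁻ v, ρ u * ρ v * (f (s + u) * f (s + v)) := by
    intro s
    rw [sq]
    nth_rw 1 [smooth]
    rw [← lintegral_mul_const _ (by fun_prop)]
    refine lintegral_congr fun u => ?_
    rw [smooth, ← lintegral_const_mul _ (by fun_prop)]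
    exact lintegral_congr fun v => by ring
  unfold sqNorm
  simp only [e]
  rw [lintegral_lintegral_swap
    (Measurable.aemeasurable (Measurable.lintegral_prod_right'
      (f := fun z : (ℝ × ℝ) × ℝ => ρ z.1.2 * ρ z.2 * (f (z.1.1 + z.1.2) * f (z.1.1 + z.2)))
      (by fun_prop)))]
  refine lintegral_congr fun u => ?_
  rw [lintegral_lintegral_swap (Measurable.aemeasurable (by fun_prop))]
  refine lintegral_congr fun v => ?_
  rw [lintegral_const_mul _ (by fun_prop)]
  congr 1
  rw [autocorr, ← lintegral_add_right_eq_self (fun x => f (x + (u - v)) * f x) v]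
  refine lintegral_congr fun s => ?_
  congr 2
  ring

theorem autocorr_le {f : ℝ → ℝ≥0∞} (hf : Measurable f) (w : ℝ) : autocorr f w ≤ sqNorm f := by
  have h := sq_lintegral_mul_le (μ := volume) (f := fun x => f (x + w)) (g := f)
    (by fun_prop) (by fun_prop)
  rw [lintegral_add_right_eq_self (fun x => f x ^ 2) w, ← sq] at h
  exact (ENNReal.pow_le_pow_left_iff two_ne_zero).1 h

/-- A function with a fixed fraction of its mass on an interval of radius `R` has an
autocorrelation that is bounded away from its maximum, for translations longer than `w₀`. -/
theorem autocorr_le_of_mass {R w₀ ε : ℝ} (p : ℕ) (hp : 2 * R < p * w₀)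
    (hε : 16384 * (p : ℝ) ^ 2 * ε ≤ 1) (hε1 : ε < 1 / 2) {f : ℝ → ℝ≥0∞} (hf : Measurable f)
    (hN : sqNorm f ≠ ∞) {z : ℝ}
    (hz : sqNorm f < 4 * ∫⁻ x in Icc (z - R) (z + R), f x ^ 2) {w : ℝ} (hw : w₀ ≤ |w|) :
    autocorr f w ≤ ENNReal.ofReal (1 - 2 * ε) * sqNorm f := by
  -- Displacements need subtraction, hence real values. Finiteness of `sqNorm f` makes f finite
  -- almost everywhere.
  set F : ℝ → ℝ := fun x => (f x).toReal
  have hF : Measurable F := hf.ennreal_toReal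
  have hF0 : ∀ x, 0 ≤ F x := fun x => ENNReal.toReal_nonneg
  have hfin : ∀ᵐ x, f x = ENNReal.ofReal (F x) := by
    have h := ae_lt_top (by fun_prop) hN
    filter_upwards [h] with x hx
    refine (ENNReal.ofReal_toReal ?_).symm
    intro h'
    simp [h'] at hx
  have hfin2 : ∀ᵐ x, f x ^ 2 = ENNReal.ofReal (F x ^ 2) := by
    filter_upwards [hfin] with x hx
    rw [hx, ENNReal.ofReal_pow (hF0 x)]
  have eN : ∫⁻ x, ENNReal.ofReal (F x ^ 2) = sqNorm f := (lintegral_congr_ae hfin2).symm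
  have eM : ∫⁻ x in Icc (z - R) (z + R), ENNReal.ofReal (F x ^ 2)
      = ∫⁻ x in Icc (z - R) (z + R), f x ^ 2 :=
    (lintegral_congr_ae (ae_restrict_of_ae hfin2)).symm
  have eC : autocorr (fun x => ENNReal.ofReal (F x)) w = autocorr f w := by
    refine lintegral_congr_ae ?_
    have h2 := (measurePreserving_add_right volume w).quasiMeasurePreserving.ae hfin
    filter_upwards [hfin, h2] with x hx hx'
    rw [← hx, ← hx']
  have hD := displacement_add_autocorr hF hF0 w
  rw [eN, eC] at hD
  have hpw : 2 * R < |p * w| := by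
    rw [abs_mul, Nat.abs_cast]
    exact hp.trans_le (by gcongr)
  -- Sixteen copies of more than a quarter of the norm N give more than 4N, against 2N + 2·16³·p²·D
  -- on the right. If the claim failed then D < 4εN, and the condition 4·16³·p²·ε ≤ 1 would bound
  -- the right side by 4N.
  have hM := nat_mul_lintegral_Icc_le hF (z := z) hpw 16
  rw [eN, eM] at hM
  have hM2 := hM.trans (add_le_add_right (mul_le_mul_right (displacement_nat_mul_le hF w p) _) _)
  have hDt : displacement F w ≠ ∞ := by
    intro h; rw [h, top_add] at hD
    exact ENNReal.mul_ne_top (by simp) hN hD.symm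
  have hCt : autocorr f w ≠ ∞ := ne_top_of_le_ne_top hN (autocorr_le hf w)
  have hMt : ∫⁻ x in Icc (z - R) (z + R), f x ^ 2 ≠ ∞ :=
    ne_top_of_le_ne_top hN (setLIntegral_le_lintegral _ _)
  lift sqNorm f to NNReal using hN with N
  lift displacement F w to NNReal using hDt with D
  lift autocorr f w to NNReal using hCt with C
  lift ∫⁻ x in Icc (z - R) (z + R), f x ^ 2 to NNReal using hMt with m
  have hz' : (N : ℝ) < 4 * m := by exact_mod_cast hz
  have hD' : (D : ℝ) + 2 * C = 2 * N := by exact_mod_cast hD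
  have hM' : (16 : ℝ) * m ≤ 2 * N + 2 * 16 ^ 3 * (p ^ 2 * D) := by exact_mod_cast hM2
  rw [ENNReal.ofReal, ← ENNReal.coe_mul, ENNReal.coe_le_coe, ← NNReal.coe_le_coe, NNReal.coe_mul,
    Real.coe_toNNReal _ (by linarith)]
  by_contra! hcon
  have h1 : (D : ℝ) < 4 * ε * N := by nlinarith
  have h2 : 8192 * (p : ℝ) ^ 2 * D ≤ 8192 * (p : ℝ) ^ 2 * (4 * ε * N) := by gcongr
  have h3 : (16384 * (p : ℝ) ^ 2 * ε) * N ≤ 1 * N := by gcongr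
  nlinarith

/-- Averaging strictly decreases the `L²` norm of functions that have a fixed fraction of their
mass on an interval of given length, uniformly in the averaging density. -/
theorem exists_sqNorm_smooth_le (κ R : ℝ) (hκ : 0 < κ) : ∃ ε : ℝ, 0 < ε ∧ ε < 1 / 2 ∧
    ∀ ρ : ℝ → ℝ≥0∞, Measurable ρ → ∫⁻ u, ρ u = 1 → (∀ u, ρ u ≤ ENNReal.ofReal κ) →
    ∀ f : ℝ → ℝ≥0∞, Measurable f →
    (∃ z, sqNorm f < 4 * ∫⁻ x in Icc (z - R) (z + R), f x ^ 2) →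
    sqNorm (smooth ρ f) ≤ ENNReal.ofReal (1 - ε) * sqNorm f := by
  -- Two independent variables with density at most κ lie within w₀ of each other with probability
  -- at most 2κw₀ = 1/2. So the gain 2ε in the autocorrelation at distance at least w₀ survives at
  -- least half of the time, which leaves the factor 1 - ε.
  set w₀ : ℝ := 1 / (4 * κ) with hw0
  have hw₀ : 0 < w₀ := by positivity
  obtain ⟨p, hp⟩ := exists_nat_gt (max 1 (2 * R / w₀))
  have hp1 : (1 : ℝ) < p := (le_max_left _ _).trans_lt hp
  have hp2 : 2 * R < p * w₀ := (div_lt_iff₀ hw₀).1 ((le_max_right _ _).trans_lt hp)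
  set ε : ℝ := 1 / (16384 * (p : ℝ) ^ 2) with hε
  have hε0 : 0 < ε := by positivity
  have hε1 : ε < 1 / 2 := by
    rw [hε, div_lt_div_iff₀ (by positivity) (by norm_num)]
    nlinarith
  refine ⟨ε, hε0, hε1, fun ρ hρ h1 hb f hf ⟨z, hz⟩ => ?_⟩
  by_cases hN : sqNorm f = ∞
  · rw [hN, ENNReal.mul_top (by simp; linarith)]
    exact le_top
  have hC : ∀ w, autocorr f w ≤ ENNReal.ofReal (1 - 2 * ε) * sqNorm f
      + ENNReal.ofReal (2 * ε) * sqNorm f * (Ioo (-w₀) w₀).indicator 1 w := by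
    intro w
    by_cases hw : w₀ ≤ |w|
    · refine (autocorr_le_of_mass p hp2 ?_ hε1 hf hN hz hw).trans le_self_add
      rw [hε, mul_one_div_cancel (by positivity)]
    · have hmem : w ∈ Ioo (-w₀) w₀ := abs_lt.1 (not_le.1 hw)
      rw [indicator_of_mem hmem, Pi.one_apply, mul_one, ← add_mul,
        ← ENNReal.ofReal_add (by linarith) (by linarith)]
      simpa using autocorr_le hf w
  have hnear : ∀ u, ∫⁻ v, ρ v * (Ioo (-w₀) w₀).indicator 1 (u - v) ≤ ENNReal.ofReal (1 / 2) := by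
    intro u
    calc ∫⁻ v, ρ v * (Ioo (-w₀) w₀).indicator 1 (u - v)
        ≤ ∫⁻ v, ENNReal.ofReal κ * (Ioo (u - w₀) (u + w₀)).indicator 1 v := by
          refine lintegral_mono fun v => mul_le_mul' (hb v) (le_of_eq ?_)
          simp only [indicator, mem_Ioo]
          congr 1
          simp only [eq_iff_iff]
          constructor <;> rintro ⟨h, h'⟩ <;> constructor <;> linarith
      _ = ENNReal.ofReal (1 / 2) := by
          rw [lintegral_const_mul _ (measurable_one.indicator measurableSet_Ioo),
            lintegral_indicator_one measurableSet_Ioo, Real.volume_Ioo, ← ENNReal.ofReal_mul hκ.le]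
          congr 1
          rw [hw0]; field_simp; ring
  have hind : Measurable ((Ioo (-w₀) w₀).indicator (1 : ℝ → ℝ≥0∞)) :=
    measurable_one.indicator measurableSet_Ioo
  rw [sqNorm_smooth_eq hρ hf]
  calc ∫⁻ u, ∫⁻ v, ρ u * ρ v * autocorr f (u - v)
      ≤ ∫⁻ u, ∫⁻ v, ((ENNReal.ofReal (1 - 2 * ε) * sqNorm f) * ρ u * ρ v
        + ENNReal.ofReal (2 * ε) * sqNorm f * ρ u
          * (ρ v * (Ioo (-w₀) w₀).indicator 1 (u - v))) := by
        refine lintegral_mono fun u => lintegral_mono fun v => ?_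
        refine (mul_le_mul_right (hC (u - v)) _).trans (le_of_eq ?_)
        ring
    _ ≤ ∫⁻ u, (ENNReal.ofReal (1 - 2 * ε) * sqNorm f * ρ u
        + ENNReal.ofReal (2 * ε) * sqNorm f * ρ u * ENNReal.ofReal (1 / 2)) := by
        refine lintegral_mono fun u => ?_
        beta_reduce
        rw [lintegral_add_left (by fun_prop), lintegral_const_mul _ hρ,
          lintegral_const_mul _ (by fun_prop), h1, mul_one]
        gcongr
        exact hnear u
    _ = ENNReal.ofReal (1 - ε) * sqNorm f := by
        rw [lintegral_add_left (by fun_prop), lintegral_const_mul _ hρ,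
          lintegral_mul_const _ (by fun_prop), lintegral_const_mul _ hρ, h1, mul_one, mul_one,
          mul_right_comm, ← ENNReal.ofReal_mul (by linarith), ← add_mul,
          ← ENNReal.ofReal_add (by linarith) (by linarith)]
        congr 2
        ring

/-! ### Inversion and the two-step contraction. -/

/-- The unitary inversion `(U_a f)(t) = (a / |t|) f(a² / t)`. -/
def inversion (a : ℝ) (f : ℝ → ℝ≥0∞) (t : ℝ) : ℝ≥0∞ :=
  ENNReal.ofReal (a / |t|) * f (a ^ 2 / t)

theorem measurable_inversion (a : ℝ) {f : ℝ → ℝ≥0∞} (hf : Measurable f) :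
    Measurable (inversion a f) := by
  unfold inversion
  exact (by fun_prop : Measurable fun t : ℝ => ENNReal.ofReal (a / |t|)).mul
    (hf.comp (measurable_const.div measurable_id))

/-- The squared weight (a/|t|)² is the Jacobian of t ↦ a²/t. -/
theorem setLIntegral_inversion_sq {a : ℝ} (ha : 0 < a) (f : ℝ → ℝ≥0∞)
    {S : Set ℝ} (hS : MeasurableSet S) (h0 : (0 : ℝ) ∉ S) :
    ∫⁻ t in S, inversion a f t ^ 2 = ∫⁻ s in (fun t => a ^ 2 / t) '' S, f s ^ 2 := by
  rw [lintegral_image_eq_lintegral_abs_deriv_mul (f' := fun t => -(a ^ 2) / t ^ 2) hS]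
  · refine setLIntegral_congr_fun hS fun t ht => ?_
    have ht0 : t ≠ 0 := fun h => h0 (h ▸ ht)
    simp only [inversion]
    rw [mul_pow, ← ENNReal.ofReal_pow (by positivity)]
    congr 2
    rw [div_pow, sq_abs, neg_div, abs_neg, abs_of_pos (by positivity)]
  · intro t ht
    have ht0 : t ≠ 0 := fun h => h0 (h ▸ ht)
    exact (((hasDerivAt_const t (a ^ 2)).div (hasDerivAt_id' t) ht0).congr_deriv
      (by simp)).hasDerivWithinAt
  · intro t ht u hu htu
    have ht0 : t ≠ 0 := fun h => h0 (h ▸ ht)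
    have hu0 : u ≠ 0 := fun h => h0 (h ▸ hu)
    have ha2 : a ^ 2 ≠ 0 := by positivity
    simp only at htu
    rw [div_eq_div_iff ht0 hu0] at htu
    exact (mul_left_cancel₀ ha2 htu).symm

theorem sqNorm_inversion {a : ℝ} (ha : 0 < a) (f : ℝ → ℝ≥0∞) :
    sqNorm (inversion a f) = sqNorm f := by
  have h := setLIntegral_inversion_sq ha f (S := {0}ᶜ) (measurableSet_singleton _).compl (by simp)
  have himg : (fun t : ℝ => a ^ 2 / t) '' {0}ᶜ = {0}ᶜ := by
    ext s
    simp only [mem_image, mem_compl_iff, mem_singleton_iff]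
    constructor
    · rintro ⟨t, ht, rfl⟩; positivity
    · intro hs; exact ⟨a ^ 2 / s, by positivity, by field_simp⟩
  rw [himg] at h
  have e : ∀ g : ℝ → ℝ≥0∞, ∫⁻ x in ({0}ᶜ : Set ℝ), g x = ∫⁻ x, g x := by
    intro g
    rw [restrict_compl_singleton]
  rwa [e, e] at h

theorem sqNorm_comp_sub_left (f : ℝ → ℝ≥0∞) (e : ℝ) :
    sqNorm (fun s => f (e - s)) = sqNorm f :=
  lintegral_sub_left_eq_self (fun x => f x ^ 2) e

/-- Two averaging steps separated by an inversion contract the `L²` norm: a function and its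
inversion cannot both be spread out. -/
theorem exists_contraction (κ A : ℝ) (hκ : 0 < κ) (hA : 0 < A) : ∃ q : ℝ, 0 < q ∧ q < 1 ∧
    ∀ ρ₁ ρ₂ : ℝ → ℝ≥0∞, Measurable ρ₁ → Measurable ρ₂ → ∫⁻ u, ρ₁ u = 1 → ∫⁻ u, ρ₂ u = 1 →
    (∀ u, ρ₁ u ≤ ENNReal.ofReal κ) → (∀ u, ρ₂ u ≤ ENNReal.ofReal κ) →
    ∀ a e : ℝ, 0 < a → a ≤ A → ∀ f : ℝ → ℝ≥0∞, Measurable f →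
    sqNorm (smooth ρ₁ fun s => inversion a (smooth ρ₂ f) (e - s))
      ≤ ENNReal.ofReal q * sqNorm f := by
  -- The window radius is A because, for a ≤ A, the map t ↦ a²/t carries the complement of [-A, A]
  -- into [-A, A].
  obtain ⟨ε, hε0, hε1, H⟩ := exists_sqNorm_smooth_le κ A hκ
  refine ⟨1 - ε, by linarith, by linarith, ?_⟩
  intro ρ₁ ρ₂ m₁ m₂ i₁ i₂ b₁ b₂ a e ha haA f hf
  set h := smooth ρ₂ f with hh
  have mh : Measurable h := measurable_smooth m₂ hf
  have mg : Measurable (inversion a h) := measurable_inversion a mh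
  have mg' : Measurable fun s => inversion a h (e - s) := mg.comp (by fun_prop)
  have eg : sqNorm (fun s => inversion a h (e - s)) = sqNorm h := by
    rw [sqNorm_comp_sub_left, sqNorm_inversion ha]
  have hhf : sqNorm h ≤ sqNorm f := sqNorm_smooth_le m₂ i₂ hf
  by_cases c₁ : ∃ z, sqNorm f < 4 * ∫⁻ x in Icc (z - A) (z + A), f x ^ 2
  · calc _ ≤ sqNorm (fun s => inversion a h (e - s)) := sqNorm_smooth_le m₁ i₁ mg'
      _ = sqNorm h := eg
      _ ≤ _ := H ρ₂ m₂ i₂ b₂ f hf c₁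
  by_cases c₂ : ∃ z, sqNorm (fun s => inversion a h (e - s))
      < 4 * ∫⁻ x in Icc (z - A) (z + A), inversion a h (e - x) ^ 2
  · calc _ ≤ ENNReal.ofReal (1 - ε) * sqNorm (fun s => inversion a h (e - s)) :=
          H ρ₁ m₁ i₁ b₁ _ mg' c₂
      _ ≤ _ := by rw [eg]; gcongr
  push Not at c₁ c₂
  rw [eg] at c₂
  -- If f is spread out, every translate of [-A, A] carries at most a quarter of its squared norm.
  -- By Jensen the same bound holds on [-A, A] for the average h.
  have k₁ : 4 * ∫⁻ s in Icc (-A) A, h s ^ 2 ≤ sqNorm f := by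
    rw [mul_comm, ← ENNReal.le_div_iff_mul_le (by simp) (by simp)]
    refine setLIntegral_smooth_sq_le m₂ i₂ hf fun u => ?_
    rw [ENNReal.le_div_iff_mul_le (by simp) (by simp), mul_comm]
    refine le_trans (le_of_eq ?_) (c₁ u)
    rw [← lintegral_indicator measurableSet_Icc, ← lintegral_indicator measurableSet_Icc,
      ← lintegral_add_right_eq_self ((Icc (u - A) (u + A)).indicator fun x => f x ^ 2) u]
    congr 1
    refine lintegral_congr fun s => ?_
    simp only [indicator, mem_Icc]
    congr 1
    simp only [eq_iff_iff]
    constructor <;> rintro ⟨h, h'⟩ <;> constructor <;> linarith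
  -- The mass of h outside [-A, A] is mass of its inversion inside [-A, A]. The reflection x ↦ e - x
  -- moves that window to one centred at e.
  have k₂ : 4 * ∫⁻ s in (Icc (-A) A)ᶜ, h s ^ 2 ≤ sqNorm f := by
    refine le_trans ?_ ((c₂ e).trans hhf)
    gcongr 4 * ?_
    calc ∫⁻ s in (Icc (-A) A)ᶜ, h s ^ 2
        ≤ ∫⁻ s in (fun t => a ^ 2 / t) '' (Icc (-A) A \ {0}), h s ^ 2 := by
          refine lintegral_mono_set fun s hs => ?_
          have hs' : A < |s| := by
            by_contra! hc
            exact hs (abs_le.1 hc)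
          have hs0 : s ≠ 0 := abs_pos.1 (hA.trans hs')
          refine ⟨a ^ 2 / s, ⟨abs_le.1 ?_, by simp [hs0, ha.ne']⟩, by field_simp⟩
          rw [abs_div, abs_of_pos (by positivity), div_le_iff₀ (abs_pos.2 hs0)]
          nlinarith
      _ = ∫⁻ t in Icc (-A) A \ {0}, inversion a h t ^ 2 :=
          (setLIntegral_inversion_sq ha h (measurableSet_Icc.diff (measurableSet_singleton _))
            (by simp)).symm
      _ ≤ ∫⁻ t in Icc (-A) A, inversion a h t ^ 2 := lintegral_mono_set sdiff_subset
      _ = ∫⁻ x in Icc (e - A) (e + A), inversion a h (e - x) ^ 2 := by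
          rw [← lintegral_indicator measurableSet_Icc, ← lintegral_indicator measurableSet_Icc,
            ← lintegral_sub_left_eq_self ((Icc (-A) A).indicator fun x => inversion a h x ^ 2) e]
          refine lintegral_congr fun s => ?_
          simp only [indicator, mem_Icc]
          congr 1
          simp only [eq_iff_iff]
          constructor <;> rintro ⟨h, h'⟩ <;> constructor <;> linarith
  have k₃ : sqNorm h ≤ ENNReal.ofReal (1 - ε) * sqNorm f := by
    have : sqNorm h = (∫⁻ s in Icc (-A) A, h s ^ 2) + ∫⁻ s in (Icc (-A) A)ᶜ, h s ^ 2 :=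
      (lintegral_add_compl _ measurableSet_Icc).symm
    have k : 4 * sqNorm h ≤ 4 * (ENNReal.ofReal (1 / 2) * sqNorm f) := by
      rw [this, mul_add, ← mul_assoc]
      have : (4 : ℝ≥0∞) * ENNReal.ofReal (1 / 2) = 2 := by
        rw [show (4 : ℝ≥0∞) = ENNReal.ofReal 4 by simp, ← ENNReal.ofReal_mul (by norm_num)]
        norm_num
      rw [this, two_mul]
      exact add_le_add k₁ k₂
    rw [ENNReal.mul_le_mul_iff_right (by simp) (by simp)] at k
    refine k.trans ?_
    gcongr
    linarith
  exact (sqNorm_smooth_le m₁ i₁ mg').trans (eg.le.trans k₃)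

/-! ### Decay of the Kunz–Souillard recursion. -/

/-- The Kunz–Souillard recursion: averages over the sites `1, …, k` of the product of the
inversion weights with an initial function `g`. -/
def ksIter (r : ℝ → ℝ) (c α : ℕ → ℝ) (E : ℝ) (g : ℝ → ℝ≥0∞) : ℕ → ℝ → ℝ≥0∞
  | 0 => g
  | k + 1 => fun s =>
      ∫⁻ x, ENNReal.ofReal (r (x - c (k + 1))) * inversion (α k) (ksIter r c α E g k) (E - x - s)

section

variable {r : ℝ → ℝ} {c α : ℕ → ℝ} {E : ℝ} {g : ℝ → ℝ≥0∞}

theorem measurable_ksIter_uncurry {Y : Type*} [MeasurableSpace Y] (hr : Measurable r)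
    {h : Y → ℝ → ℝ≥0∞} (hh : Measurable (Function.uncurry h)) (k : ℕ) :
    Measurable (Function.uncurry fun y => ksIter r c α E (h y) k) := by
  induction k with
  | zero => exact hh
  | succ k ih =>
    refine Measurable.lintegral_prod_right' (f := fun z : (Y × ℝ) × ℝ =>
      ENNReal.ofReal (r (z.2 - c (k + 1))) *
        inversion (α k) (ksIter r c α E (h z.1.1) k) (E - z.2 - z.1.2)) ?_
    refine Measurable.mul (by fun_prop) (Measurable.mul (by fun_prop) ?_)
    exact ih.comp (Measurable.prodMk (by fun_prop)
      (measurable_const.div (by fun_prop)))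

theorem measurable_ksIter (hr : Measurable r) (hg : Measurable g) (k : ℕ) :
    Measurable (ksIter r c α E g k) :=
  (measurable_ksIter_uncurry (Y := Unit) (h := fun _ => g) hr (hg.comp measurable_snd) k).comp
    (measurable_prodMk_left (x := ()))

/-- Recentring the density at 0 presents a step as averaging after reflection and inversion. The
centre of the site only shifts the reflection point, hence the uniformity in the centres. -/
theorem ksIter_succ_eq_smooth (k : ℕ) :
    ksIter r c α E g (k + 1) = smooth (fun u => ENNReal.ofReal (r u))
      (fun s => inversion (α k) (ksIter r c α E g k) (E - c (k + 1) - s)) := by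
  funext s
  simp only [ksIter, smooth]
  rw [← lintegral_add_right_eq_self (fun x => ENNReal.ofReal (r (x - c (k + 1))) *
    inversion (α k) (ksIter r c α E g k) (E - x - s)) (c (k + 1))]
  refine lintegral_congr fun u => ?_
  rw [add_sub_cancel_right]
  congr 2
  ring

theorem measurable_inversion_ksIter (hr : Measurable r) (hg : Measurable g) (k : ℕ) (e : ℝ) :
    Measurable fun s => inversion (α k) (ksIter r c α E g k) (e - s) :=
  (measurable_inversion _ (measurable_ksIter hr hg k)).comp (by fun_prop)

variable {κ q : ℝ}

theorem lintegral_density (hr0 : ∀ x, 0 ≤ r x) (hr1 : ∫ x, r x = 1) :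
    ∫⁻ u, ENNReal.ofReal (r u) = 1 := by
  have hint : Integrable r := by
    by_contra h
    rw [integral_undef h] at hr1
    exact zero_ne_one hr1
  rw [← ofReal_integral_eq_lintegral_ofReal hint (Filter.Eventually.of_forall hr0), hr1,
    ENNReal.ofReal_one]

theorem sqNorm_ksIter_succ_le (hr : Measurable r) (h1 : ∫⁻ u, ENNReal.ofReal (r u) = 1)
    (hα : ∀ k, 0 < α k) (hg : Measurable g) (k : ℕ) :
    sqNorm (ksIter r c α E g (k + 1)) ≤ sqNorm (ksIter r c α E g k) := by
  rw [ksIter_succ_eq_smooth]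
  refine (sqNorm_smooth_le (by fun_prop) h1 (measurable_inversion_ksIter hr hg k _)).trans ?_
  rw [sqNorm_comp_sub_left, sqNorm_inversion (hα k)]

/-- The contraction uses two averages, so steps are taken in pairs. This is the source of the
exponent k / 2, rounded down. -/
theorem sqNorm_ksIter_le (hr : Measurable r) (h1 : ∫⁻ u, ENNReal.ofReal (r u) = 1)
    (hα : ∀ k, 0 < α k) (hg : Measurable g)
    (hstep : ∀ k f, Measurable f → ∀ e, sqNorm (smooth (fun u => ENNReal.ofReal (r u))
      fun s => inversion (α k) (smooth (fun u => ENNReal.ofReal (r u)) f) (e - s))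
        ≤ ENNReal.ofReal q * sqNorm f) (k : ℕ) :
    sqNorm (ksIter r c α E g k) ≤ ENNReal.ofReal q ^ (k / 2) * sqNorm g := by
  induction k using Nat.strong_induction_on with
  | _ k ih =>
    match k, ih with
    | 0, _ => simp [ksIter]
    | 1, _ => simpa [ksIter] using sqNorm_ksIter_succ_le hr h1 hα hg 0
    | k + 2, ih =>
      have e : (k + 2) / 2 = k / 2 + 1 := by omega
      rw [e, pow_succ', mul_assoc, ksIter_succ_eq_smooth, ksIter_succ_eq_smooth]
      refine (hstep (k + 1) _ (measurable_inversion_ksIter hr hg k _) _).trans ?_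
      rw [sqNorm_comp_sub_left, sqNorm_inversion (hα k)]
      gcongr
      exact ih k (by omega)

/-- One last average turns the L² bound into a pointwise one: Cauchy–Schwarz, with ∫ r² ≤ κ ∫ r = κ.
-/
theorem ksIter_succ_sq_le (hr : Measurable r) (h1 : ∫⁻ u, ENNReal.ofReal (r u) = 1)
    (hα : ∀ k, 0 < α k) (hg : Measurable g) (hκ : ∀ x, r x ≤ κ) (k : ℕ) (s : ℝ) :
    ksIter r c α E g (k + 1) s ^ 2 ≤ ENNReal.ofReal κ * sqNorm (ksIter r c α E g k) := by
  have m := measurable_inversion_ksIter (c := c) (α := α) (E := E) hr hg k (E - c (k + 1))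
  rw [ksIter_succ_eq_smooth, smooth]
  refine (sq_lintegral_mul_le (g := fun u => inversion (α k) (ksIter r c α E g k)
    (E - c (k + 1) - (s + u))) (by fun_prop)
    (m.comp (measurable_const_add s)).aemeasurable).trans ?_
  refine mul_le_mul' ?_ (le_of_eq ?_)
  · calc ∫⁻ u, ENNReal.ofReal (r u) ^ 2 ≤ ∫⁻ u, ENNReal.ofReal κ * ENNReal.ofReal (r u) := by
          refine lintegral_mono fun u => ?_
          rw [sq]
          gcongr
          exact hκ u
      _ = ENNReal.ofReal κ := by rw [lintegral_const_mul _ (by fun_prop), h1, mul_one]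
  · rw [← sqNorm_inversion (hα k) (ksIter r c α E g k),
      ← sqNorm_comp_sub_left _ (E - c (k + 1) - s), sqNorm]
    refine lintegral_congr fun u => ?_
    congr 2
    ring

end

/-- Exponential decay of the Kunz–Souillard recursion, uniformly in the energy, the centres of the
single-site densities and the initial function. -/
theorem exists_ksIter_le {r : ℝ → ℝ} (hr : Measurable r) (hr0 : ∀ x, 0 ≤ r x)
    (hr1 : ∫ x, r x = 1) {κ A B : ℝ} (hκ0 : 0 < κ) (hκ : ∀ x, r x ≤ κ) (hA : 0 < A) :
    ∃ C γ : ℝ, 0 < C ∧ 0 < γ ∧ ∀ (c α : ℕ → ℝ) (E : ℝ) (g : ℝ → ℝ≥0∞), (∀ k, 0 < α k) →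
      (∀ k, α k ≤ A) → Measurable g → (∀ s, g s ≤ ENNReal.ofReal κ) →
      sqNorm g ≤ ENNReal.ofReal B → ∀ (k : ℕ) (s : ℝ),
      ksIter r c α E g k s ≤ ENNReal.ofReal (C * Real.exp (-γ * k)) := by
  obtain ⟨q, hq0, hq1, hq⟩ := exists_contraction κ A hκ0 hA
  have h1 := lintegral_density hr0 hr1
  -- Two steps gain q in the squared norm, hence q^(1/4) = σ per step in the norm. The factor 1/σ²
  -- in the constant pays for rounding k / 2 down and for the step spent on the pointwise bound.
  set γ : ℝ := -Real.log q / 4 with hγ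
  have hγ0 : 0 < γ := by have := Real.log_neg hq0 hq1; rw [hγ]; linarith
  have hqe : q = Real.exp (-γ) ^ 4 := by
    rw [← Real.exp_nat_mul, hγ]
    conv_lhs => rw [← Real.exp_log hq0]
    congr 1; push_cast; ring
  set σ : ℝ := Real.exp (-γ) with hσ
  have hσ0 : 0 < σ := Real.exp_pos _
  have hσ1 : σ ≤ 1 := Real.exp_le_one_iff.2 (by linarith)
  set D : ℝ := Real.sqrt (κ * max B 0) with hD
  have hD2 : D ^ 2 = κ * max B 0 := Real.sq_sqrt (by positivity)
  have hDn : 0 ≤ D := Real.sqrt_nonneg _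
  refine ⟨κ + D / σ ^ 2, γ, by positivity, hγ0, ?_⟩
  intro c α E g hα hαA hg hgκ hgB k s
  have hexp : ∀ k : ℕ, Real.exp (-γ * k) = σ ^ k := fun k => by
    rw [hσ, ← Real.exp_nat_mul]; congr 1; ring
  rw [hexp]
  cases k with
  | zero =>
    refine (hgκ s).trans (ENNReal.ofReal_le_ofReal ?_)
    rw [pow_zero, mul_one]
    have : 0 ≤ D / σ ^ 2 := by positivity
    linarith
  | succ k =>
    have b : ksIter r c α E g (k + 1) s ^ 2 ≤ ENNReal.ofReal (D / σ ^ 2 * σ ^ (k + 1)) ^ 2 := by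
      refine (ksIter_succ_sq_le hr h1 hα hg hκ k s).trans ?_
      have n1 := sqNorm_ksIter_le (c := c) (E := E) (q := q) hr h1 hα hg
        (fun k f hf e => hq _ _ (by fun_prop) (by fun_prop) h1 h1
          (fun u => ENNReal.ofReal_le_ofReal (hκ u)) (fun u => ENNReal.ofReal_le_ofReal (hκ u))
          (α k) e (hα k) (hαA k) f hf) k
      calc ENNReal.ofReal κ * sqNorm (ksIter r c α E g k)
          ≤ ENNReal.ofReal κ * (ENNReal.ofReal q ^ (k / 2) * ENNReal.ofReal (max B 0)) := by
            gcongr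
            refine n1.trans ?_
            gcongr
            exact hgB.trans (ENNReal.ofReal_le_ofReal (le_max_left _ _))
        _ = ENNReal.ofReal (D ^ 2 * q ^ (k / 2)) := by
            rw [← ENNReal.ofReal_pow hq0.le, ← ENNReal.ofReal_mul (by positivity),
              ← ENNReal.ofReal_mul hκ0.le, hD2]
            congr 1; ring
        _ ≤ _ := by
            rw [← ENNReal.ofReal_pow (by positivity)]
            refine ENNReal.ofReal_le_ofReal ?_
            rw [mul_pow, div_pow, hqe, ← pow_mul, ← pow_mul, ← pow_mul, div_mul_eq_mul_div,
              le_div_iff₀ (by positivity), mul_assoc, ← pow_add]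
            gcongr ?_ * ?_
            exact pow_le_pow_of_le_one hσ0.le hσ1 (by omega)
    refine ((ENNReal.pow_le_pow_left_iff two_ne_zero).1 b).trans (ENNReal.ofReal_le_ofReal ?_)
    gcongr
    linarith

/-! ### Continued fractions and Dirichlet solutions on a half-line. -/

/-- The characteristic polynomial of the `k × k` Jacobi matrix with diagonal
`β i, …, β (i + k - 1)` and off-diagonal `α i, …, α (i + k - 2)`. -/
def jacobiPoly (α β : ℕ → ℝ) : ℕ → ℕ → Polynomial ℝ
  | 0, _ => 1
  | 1, i => Polynomial.X - Polynomial.C (β i)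
  | k + 2, i => (Polynomial.X - Polynomial.C (β i)) * jacobiPoly α β (k + 1) (i + 1)
      - Polynomial.C (α i ^ 2) * jacobiPoly α β k (i + 2)

/-- The finite continued fraction `E - β i - (α i)² / (E - β (i + 1) - …)` with `k` levels. -/
def contFrac (α β : ℕ → ℝ) (E : ℝ) : ℕ → ℕ → ℝ
  | 0, _ => 0
  | k + 1, i => E - β i - α i ^ 2 / contFrac α β E k (i + 1)

/-- The solution on `0, …, n` of the eigenvalue equation at `1, …, n` with Dirichlet condition at
`n + 1`, normalized to be `1` at the site `0`. -/
def halfSol (α β : ℕ → ℝ) (n : ℕ) (E : ℝ) (i : ℕ) : ℝ :=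
  if i ≤ n then (∏ j ∈ Finset.range i, α j) * (jacobiPoly α β (n - i) (i + 1)).eval E /
    (jacobiPoly α β n 1).eval E else 0

theorem jacobiPoly_monic_natDegree (α β : ℕ → ℝ) (k i : ℕ) :
    (jacobiPoly α β k i).Monic ∧ (jacobiPoly α β k i).natDegree = k := by
  induction k using Nat.strong_induction_on generalizing i with
  | _ k ih =>
    match k, ih with
    | 0, _ => simp [jacobiPoly]
    | 1, _ => exact ⟨Polynomial.monic_X_sub_C _, Polynomial.natDegree_X_sub_C _⟩
    | k + 2, ih =>
      obtain ⟨m1, d1⟩ := ih (k + 1) (by omega) (i + 1)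
      obtain ⟨m2, d2⟩ := ih k (by omega) (i + 2)
      have m := (Polynomial.monic_X_sub_C (β i)).mul m1
      have d : ((Polynomial.X - Polynomial.C (β i)) * jacobiPoly α β (k + 1) (i + 1)).natDegree
          = k + 2 := by
        rw [(Polynomial.monic_X_sub_C (β i)).natDegree_mul m1, d1, Polynomial.natDegree_X_sub_C]
        omega
      have hlt : (Polynomial.C (α i ^ 2) * jacobiPoly α β k (i + 2)).natDegree < k + 2 :=
        (Polynomial.natDegree_C_mul_le _ _).trans_lt (by omega)
      have hlt' : (Polynomial.C (α i ^ 2) * jacobiPoly α β k (i + 2)).degree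
          < ((Polynomial.X - Polynomial.C (β i)) * jacobiPoly α β (k + 1) (i + 1)).degree := by
        refine Polynomial.degree_lt_degree ?_
        rwa [d]
      refine ⟨m.sub_of_left hlt', ?_⟩
      rw [jacobiPoly, Polynomial.natDegree_sub_eq_left_of_natDegree_lt (by rwa [d]), d]

/-- Only integrals over E matter, so the countably many energies at which some denominator vanishes
can be discarded. -/
theorem ae_eval_jacobiPoly_ne_zero (α β : ℕ → ℝ) :
    ∀ᵐ E : ℝ, ∀ k i, (jacobiPoly α β k i).eval E ≠ 0 := by
  refine ae_all_iff.2 fun k => ae_all_iff.2 fun i => ?_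
  have h := (jacobiPoly_monic_natDegree α β k i).1.ne_zero
  have hf : {E : ℝ | (jacobiPoly α β k i).eval E = 0}.Finite :=
    ((jacobiPoly α β k i).roots.toFinset.finite_toSet).subset fun E hE => by simpa [h] using hE
  simpa [ae_iff] using hf.measure_zero volume

section

variable {α β : ℕ → ℝ} {E : ℝ} {n : ℕ}

/-- The recurrence of the polynomials divided by its second factor. The convention x / 0 = 0 makes
the innermost level E - β. -/
theorem contFrac_succ_eq (h : ∀ k i, (jacobiPoly α β k i).eval E ≠ 0) (k i : ℕ) :
    contFrac α β E (k + 1) i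
      = (jacobiPoly α β (k + 1) i).eval E / (jacobiPoly α β k (i + 1)).eval E := by
  induction k generalizing i with
  | zero => simp [contFrac, jacobiPoly]
  | succ k ih =>
    have h1 := h (k + 1) (i + 1)
    rw [contFrac, ih, jacobiPoly]
    simp only [Polynomial.eval_sub, Polynomial.eval_mul, Polynomial.eval_X, Polynomial.eval_C]
    field_simp

/-- A continued fraction sees only the sites from i onward. This is what allows the sites to be
integrated out successively from the pivot. -/
theorem contFrac_congr {β' : ℕ → ℝ} {i : ℕ} (h : ∀ j, i ≤ j → β j = β' j) (k : ℕ) :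
    contFrac α β E k i = contFrac α β' E k i := by
  induction k generalizing i with
  | zero => rfl
  | succ k ih => rw [contFrac, contFrac, h i le_rfl, ih fun j hj => h j (by omega)]

theorem halfSol_zero (h : (jacobiPoly α β n 1).eval E ≠ 0) : halfSol α β n E 0 = 1 := by
  simp [halfSol, h]

theorem halfSol_of_lt {i : ℕ} (hi : n < i) : halfSol α β n E i = 0 := by
  simp [halfSol, not_le.2 hi]

theorem halfSol_eq (i : ℕ) (hi : i + 1 ≤ n) :
    α (i + 1) * halfSol α β n E (i + 2) + α i * halfSol α β n E i
      + β (i + 1) * halfSol α β n E (i + 1) = E * halfSol α β n E (i + 1) := by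
  obtain ⟨k, rfl⟩ := Nat.exists_eq_add_of_le hi
  have e1 : i + 1 + k - (i + 1) = k := by omega
  have e0 : i + 1 + k - i = k + 1 := by omega
  cases k with
  | zero =>
    simp only [halfSol, e0, e1, Finset.prod_range_succ, jacobiPoly]
    simp
    ring
  | succ k =>
    have e2 : i + 1 + (k + 1) - (i + 2) = k := by omega
    have l2 : i + 2 ≤ i + 1 + (k + 1) := by omega
    have l1 : i + 1 ≤ i + 1 + (k + 1) := by omega
    have l0 : i ≤ i + 1 + (k + 1) := by omega
    simp only [halfSol, e0, e1, e2, l0, l1, l2, if_true, Finset.prod_range_succ]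
    rw [show jacobiPoly α β (k + 1 + 1) (i + 1) = _ from jacobiPoly.eq_3 α β (i + 1) k]
    simp only [Polynomial.eval_sub, Polynomial.eval_mul, Polynomial.eval_X, Polynomial.eval_C]
    rw [show i + 1 + 1 = i + 2 from rfl, show i + 1 + 2 = i + 2 + 1 from rfl]
    ring

theorem mul_halfSol_one (h : ∀ k i, (jacobiPoly α β k i).eval E ≠ 0) :
    α 0 * halfSol α β n E 1 = α 0 ^ 2 / contFrac α β E n 1 := by
  cases n with
  | zero => simp [halfSol, contFrac]
  | succ n =>
    rw [contFrac_succ_eq h, div_div_eq_mul_div]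
    simp [halfSol]
    ring

/-- The factors are the ratios of consecutive values of the solution, and the product telescopes. -/
theorem abs_halfSol_eq (h : ∀ k i, (jacobiPoly α β k i).eval E ≠ 0) (hα : ∀ i, 0 < α i) {m : ℕ}
    (hm : m ≤ n) :
    |halfSol α β n E m| = ∏ j ∈ Finset.range m, α j / |contFrac α β E (n - j) (j + 1)| := by
  induction m with
  | zero => simp [halfSol, h]
  | succ m ih =>
    rw [Finset.prod_range_succ, ← ih (by omega)]
    obtain ⟨k, rfl⟩ := Nat.exists_eq_add_of_le hm
    have e1 : m + 1 + k - (m + 1) = k := by omega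
    have e0 : m + 1 + k - m = k + 1 := by omega
    have l0 : m ≤ m + 1 + k := by omega
    rw [e0, contFrac_succ_eq h]
    simp only [halfSol, l0, hm, if_true, e0, e1, Finset.prod_range_succ, abs_mul, abs_div,
      abs_of_pos (hα m)]
    have h1 := abs_pos.2 (h (k + 1) (m + 1))
    have h2 := abs_pos.2 (h k (m + 1 + 1))
    have h3 := abs_pos.2 (h (m + 1 + k) 1)
    field_simp

/-- Solve backwards from the Dirichlet end n + 1. The induction is on the distance k from the last
site n, and the value there is the only free parameter. -/
theorem mul_prod_eq_of_solution {u : ℕ → ℝ} (hu : u (n + 1) = 0)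
    (heq : ∀ i, i + 1 ≤ n → α (i + 1) * u (i + 2) + α i * u i + β (i + 1) * u (i + 1)
      = E * u (i + 1)) (k i : ℕ) (hki : i + k = n) :
    u i * ∏ j ∈ Finset.range k, α (i + j) = u n * (jacobiPoly α β k (i + 1)).eval E := by
  induction k using Nat.strong_induction_on generalizing i with
  | _ k ih =>
    match k, ih with
    | 0, _ => subst hki; simp [jacobiPoly]
    | 1, _ =>
      subst hki
      have := heq i le_rfl
      rw [Finset.prod_range_one, jacobiPoly, add_zero, Polynomial.eval_sub, Polynomial.eval_X,
        Polynomial.eval_C]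
      rw [hu] at this
      linarith
    | k + 2, ih =>
      have h1 := ih (k + 1) (by omega) (i + 1) (by omega)
      have h2 := ih k (by omega) (i + 2) (by omega)
      have h0 := heq i (by omega)
      have s1 : ∏ j ∈ Finset.range (k + 1), α (i + 1 + j)
          = (∏ j ∈ Finset.range k, α (i + 2 + j)) * α (i + 1) := by
        rw [Finset.prod_range_succ', add_zero]
        congr 1
        exact Finset.prod_congr rfl fun j _ => congrArg α (by omega)
      have s2 : ∏ j ∈ Finset.range (k + 2), α (i + j)
          = (∏ j ∈ Finset.range k, α (i + 2 + j)) * α (i + 1) * α i := by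
        rw [Finset.prod_range_succ', ← s1, add_zero]
        congr 1
        exact Finset.prod_congr rfl fun j _ => congrArg α (by omega)
      rw [s1] at h1
      rw [s2]
      rw [jacobiPoly]
      simp only [Polynomial.eval_sub, Polynomial.eval_mul, Polynomial.eval_X, Polynomial.eval_C]
      rw [show i + 1 + 2 = i + 2 + 1 from rfl]
      linear_combination (∏ j ∈ Finset.range k, α (i + 2 + j)) * α (i + 1) * h0
        + (E - β (i + 1)) * h1 - α (i + 1) ^ 2 * h2

/-- A solution not vanishing at 0 excludes E from the Dirichlet spectrum of 1, …, n, for otherwise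
the backward recursion would give u 0 = 0. It is then determined by u 0. -/
theorem solution_eq_halfSol (hα : ∀ i, 0 < α i) {u : ℕ → ℝ} (hu : u (n + 1) = 0)
    (heq : ∀ i, i + 1 ≤ n → α (i + 1) * u (i + 2) + α i * u i + β (i + 1) * u (i + 1)
      = E * u (i + 1)) (h0 : u 0 ≠ 0) :
    (jacobiPoly α β n 1).eval E ≠ 0 ∧ ∀ i ≤ n, u i = u 0 * halfSol α β n E i := by
  have H := mul_prod_eq_of_solution hu heq
  have hn := H n 0 (by omega)
  simp only [zero_add] at hn
  have hprod : ∀ (s : Finset ℕ) (f : ℕ → ℕ), 0 < ∏ j ∈ s, α (f j) :=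
    fun s f => Finset.prod_pos fun j _ => hα _
  have hne : u n * (jacobiPoly α β n 1).eval E ≠ 0 := by
    rw [← hn]
    exact mul_ne_zero h0 (hprod _ fun j => j).ne'
  have hD := right_ne_zero_of_mul hne
  refine ⟨hD, fun i hi => ?_⟩
  have h1 := H (n - i) i (by omega)
  have h2 : ∏ j ∈ Finset.range n, α j
      = (∏ j ∈ Finset.range i, α j) * ∏ j ∈ Finset.range (n - i), α (i + j) := by
    rw [← Finset.prod_range_add]
    congr 2
    omega
  have hp := hprod (Finset.range (n - i)) fun j => i + j
  simp only [halfSol, hi, if_true]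
  rw [eq_comm, mul_div_assoc', div_eq_iff hD]
  refine mul_right_cancel₀ (b := u n * ∏ j ∈ Finset.range (n - i), α (i + j)) ?_ ?_
  · exact mul_ne_zero (left_ne_zero_of_mul hne) hp.ne'
  · rw [h2] at hn
    linear_combination ((jacobiPoly α β (n - i) (i + 1)).eval E * u n) * hn
      - u n * (jacobiPoly α β n 1).eval E * h1

theorem continuousAt_halfSol (h : (jacobiPoly α β n 1).eval E ≠ 0) (i : ℕ) :
    ContinuousAt (fun E => halfSol α β n E i) E := by
  unfold halfSol
  split_ifs
  · exact ContinuousAt.div (by fun_prop) (by fun_prop) h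
  · exact continuousAt_const

end

/-! ### Jacobi matrices of finite boxes and their eigenvectors. -/

/-- The matrix elements of the Jacobi operator. -/
def jacobiEntry (a b : ℤ → ℝ) (i j : ℤ) : ℝ :=
  (if j = i then b i else 0) + (if j = i + 1 then a i else 0) + if j = i - 1 then a (i - 1) else 0

/-- The interval of sites at distance at most `n` from `p`. -/
abbrev Box (p : ℤ) (n : ℕ) : Type := {i : ℤ // i ∈ Finset.Icc (p - n) (p + n)}

/-- The restriction of the Jacobi operator to a box. -/
def boxMatrix (a b : ℤ → ℝ) (p : ℤ) (n : ℕ) : Matrix (Box p n) (Box p n) ℝ :=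
  Matrix.of fun i j => jacobiEntry a b i j

theorem jacobiEntry_comm (a b : ℤ → ℝ) (i j : ℤ) : jacobiEntry a b i j = jacobiEntry a b j i := by
  unfold jacobiEntry
  by_cases h1 : j = i
  · subst h1; rfl
  by_cases h2 : j = i + 1
  · subst h2; simp [show ¬(i = i + 1 + 1) by omega, show ¬(i + 1 = i - 1) by omega]
  by_cases h3 : j = i - 1
  · subst h3
    simp [show ¬(i = i - 1 - 1) by omega, show ¬(i - 1 = i + 1) by omega,
      show ¬(i = i - 1) by omega]
  · have e1 : i ≠ j := Ne.symm h1
    have e2 : i ≠ j + 1 := by omega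
    have e3 : i ≠ j - 1 := by omega
    simp [*]

theorem boxMatrix_isHermitian (a b : ℤ → ℝ) (p : ℤ) (n : ℕ) : (boxMatrix a b p n).IsHermitian := by
  ext i j
  simp [boxMatrix, jacobiEntry_comm a b i j]

theorem boxMatrix_mulVec (a b : ℤ → ℝ) (p : ℤ) (n : ℕ) (u : ℤ → ℝ) (h1 : u (p + n + 1) = 0)
    (h2 : u (p - n - 1) = 0) (i : Box p n) :
    (boxMatrix a b p n).mulVec (fun j => u j) i
      = a i * u (i + 1) + a (i - 1) * u (i - 1) + b i * u i := by
  have hi := Finset.mem_Icc.1 i.2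
  rw [Matrix.mulVec, dotProduct]
  have e : ∑ j : Box p n, boxMatrix a b p n i j * u j
      = ∑ j ∈ Finset.Icc (p - n) (p + n), jacobiEntry a b i j * u j :=
    Finset.sum_coe_sort (Finset.Icc (p - n : ℤ) (p + n)) fun j => jacobiEntry a b i j * u j
  rw [e]
  simp only [jacobiEntry, add_mul, ite_mul, zero_mul, Finset.sum_add_distrib, Finset.sum_ite_eq']
  have k1 : (if (i : ℤ) + 1 ∈ Finset.Icc (p - n : ℤ) (p + n) then a i * u (i + 1) else 0)
      = a i * u (i + 1) := by
    split_ifs with h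
    · rfl
    · have : (i : ℤ) + 1 = p + n + 1 := by rw [Finset.mem_Icc] at h; omega
      rw [this, h1, mul_zero]
  have k2 : (if (i : ℤ) - 1 ∈ Finset.Icc (p - n : ℤ) (p + n) then a (i - 1) * u (i - 1) else 0)
      = a (i - 1) * u (i - 1) := by
    split_ifs with h
    · rfl
    · have : (i : ℤ) - 1 = p - n - 1 := by rw [Finset.mem_Icc] at h; omega
      rw [this, h2, mul_zero]
  rw [k1, k2, if_pos i.2]
  ring

/-- The extension by zero of a vector on a box. -/
def boxExtend {p : ℤ} {n : ℕ} (v : Box p n → ℝ) (i : ℤ) : ℝ :=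
  if h : i ∈ Finset.Icc (p - n : ℤ) (p + n) then v ⟨i, h⟩ else 0

theorem boxExtend_coe {p : ℤ} {n : ℕ} (v : Box p n → ℝ) (i : Box p n) : boxExtend v i = v i := by
  simp [boxExtend, i.2]

theorem boxExtend_of_notMem {p : ℤ} {n : ℕ} (v : Box p n → ℝ) {i : ℤ}
    (h : i ∉ Finset.Icc (p - n : ℤ) (p + n)) : boxExtend v i = 0 := by
  simp only [boxExtend, h, dite_false]

theorem boxMatrix_mulVec_apply (a b : ℤ → ℝ) (p : ℤ) (n : ℕ) (v : Box p n → ℝ) (i : Box p n) :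
    (boxMatrix a b p n).mulVec v i
      = a i * boxExtend v (i + 1) + a (i - 1) * boxExtend v (i - 1) + b i * v i := by
  have h := boxMatrix_mulVec a b p n (boxExtend v)
    (boxExtend_of_notMem v (by simp)) (boxExtend_of_notMem v (by simp)) i
  simpa only [boxExtend_coe] using h

section Eigen

variable (a b : ℤ → ℝ) (p : ℤ) (n : ℕ)

/-- The eigenvalues of the box matrix. -/
def boxEigval (k : Box p n) : ℝ := (boxMatrix_isHermitian a b p n).eigenvalues k

/-- The orthonormal eigenvectors of the box matrix. -/
def boxEigvec (k : Box p n) : Box p n → ℝ := (boxMatrix_isHermitian a b p n).eigenvectorBasis k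

/-- The eigenfunction correlator of the box matrix. -/
def boxCorrelator (x y : Box p n) : ℝ :=
  ∑ k, |boxEigvec a b p n k x * boxEigvec a b p n k y|

theorem boxMatrix_mulVec_boxEigvec (k : Box p n) :
    (boxMatrix a b p n).mulVec (boxEigvec a b p n k)
      = boxEigval a b p n k • boxEigvec a b p n k :=
  (boxMatrix_isHermitian a b p n).mulVec_eigenvectorBasis k

theorem sum_boxEigvec_mul (k l : Box p n) :
    ∑ i, boxEigvec a b p n k i * boxEigvec a b p n l i = if k = l then 1 else 0 := by
  have h := orthonormal_iff_ite.1 (boxMatrix_isHermitian a b p n).eigenvectorBasis.orthonormal k l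
  rw [← h, PiLp.inner_apply]
  refine Finset.sum_congr rfl fun i _ => ?_
  simp [boxEigvec, mul_comm]

theorem boxMatrix_pow_apply (m : ℕ) (x y : Box p n) :
    (boxMatrix a b p n ^ m) x y
      = ∑ k, boxEigval a b p n k ^ m * (boxEigvec a b p n k x * boxEigvec a b p n k y) := by
  have hm : ∀ k, (boxMatrix a b p n ^ m).mulVec (boxEigvec a b p n k)
      = boxEigval a b p n k ^ m • boxEigvec a b p n k := by
    intro k
    induction m with
    | zero => simp
    | succ m ih =>
      rw [pow_succ', ← Matrix.mulVec_mulVec, ih, Matrix.mulVec_smul, boxMatrix_mulVec_boxEigvec,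
        smul_smul, pow_succ]
  have hs : (Pi.single y 1 : Box p n → ℝ)
      = ∑ k, boxEigvec a b p n k y • boxEigvec a b p n k := by
    have h := (boxMatrix_isHermitian a b p n).eigenvectorBasis.sum_repr'
      (EuclideanSpace.single y (1 : ℝ))
    funext i
    have h' := congrArg (fun v : EuclideanSpace ℝ (Box p n) => v i) h
    simp only [PiLp.inner_apply] at h'
    simp [boxEigvec, Finset.sum_apply, Pi.single_apply] at h' ⊢
    rw [← h']
  have : (boxMatrix a b p n ^ m) x y = (boxMatrix a b p n ^ m).mulVec (Pi.single y 1) x := by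
    simp
  rw [this, hs, Matrix.mulVec_sum, Finset.sum_apply]
  refine Finset.sum_congr rfl fun k _ => ?_
  rw [Matrix.mulVec_smul, hm]
  simp
  ring

theorem sum_boxEigvec_sq (x : Box p n) : ∑ k, boxEigvec a b p n k x ^ 2 = 1 := by
  have h := boxMatrix_pow_apply a b p n 0 x x
  simp at h
  rw [h]
  exact Finset.sum_congr rfl fun k _ => sq _

/-- By 2|st| ≤ s² + t² together with completeness of the eigenbasis. -/
theorem boxCorrelator_le_one (x y : Box p n) : boxCorrelator a b p n x y ≤ 1 := by
  have h : boxCorrelator a b p n x y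
      ≤ ∑ k, (boxEigvec a b p n k x ^ 2 / 2 + boxEigvec a b p n k y ^ 2 / 2) := by
    refine Finset.sum_le_sum fun k _ => ?_
    rw [abs_le]
    constructor <;>
      nlinarith [sq_nonneg (boxEigvec a b p n k x + boxEigvec a b p n k y),
        sq_nonneg (boxEigvec a b p n k x - boxEigvec a b p n k y)]
  rw [Finset.sum_add_distrib, ← Finset.sum_div, ← Finset.sum_div, sum_boxEigvec_sq,
    sum_boxEigvec_sq] at h
  linarith

/-- Read the eigenvalue equation at a site where the eigenvector has maximal modulus. The bound does
not depend on the box. -/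
theorem abs_boxEigval_le {A B : ℝ} (hA : ∀ i, |a i| ≤ A) (hB : ∀ i, |b i| ≤ B) (k : Box p n) :
    |boxEigval a b p n k| ≤ 2 * A + B := by
  set φ := boxEigvec a b p n k
  have : Nonempty (Box p n) := ⟨k⟩
  obtain ⟨i, hi⟩ := Finite.exists_max fun i => |φ i|
  have hA0 : 0 ≤ A := (abs_nonneg _).trans (hA 0)
  have hmax : ∀ j, |boxExtend φ j| ≤ |φ i| := by
    intro j
    unfold boxExtend
    split_ifs
    · exact hi _
    · simp
  have hpos : 0 < |φ i| := by
    by_contra! hc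
    have h0 : ∀ j, φ j = 0 := fun j => abs_nonpos_iff.1 ((hi j).trans hc)
    have := sum_boxEigvec_mul a b p n k k
    change ∑ j, φ j * φ j = _ at this
    simp [h0] at this
  have heq := congrFun (boxMatrix_mulVec_boxEigvec a b p n k) i
  rw [boxMatrix_mulVec_apply] at heq
  simp only [Pi.smul_apply, smul_eq_mul] at heq
  have h1 : |boxEigval a b p n k| * |φ i| ≤ (2 * A + B) * |φ i| := by
    rw [← abs_mul, ← heq]
    refine (abs_add_three _ _ _).trans ?_
    simp only [abs_mul]
    have t1 : |a i| * |boxExtend φ (i + 1)| ≤ A * |φ i| :=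
      mul_le_mul (hA _) (hmax _) (abs_nonneg _) hA0
    have t2 : |a (i - 1)| * |boxExtend φ (i - 1)| ≤ A * |φ i| :=
      mul_le_mul (hA _) (hmax _) (abs_nonneg _) hA0
    have t3 : |b i| * |φ i| ≤ B * |φ i| := by gcongr; exact hB _
    linarith
  exact le_of_mul_le_mul_right h1 hpos

end Eigen

/-! ### Matching the two half-solutions at the pivot site. -/

section

variable (a b : ℤ → ℝ) (p : ℤ) (n : ℕ)

/-- The off-diagonal coefficients to the right of `p`. -/
def rightOff (i : ℕ) : ℝ := a (p + i)

/-- The diagonal coefficients to the right of `p`. -/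
def rightDiag (i : ℕ) : ℝ := b (p + i)

/-- The off-diagonal coefficients to the left of `p`. -/
def leftOff (i : ℕ) : ℝ := a (p - i - 1)

/-- The diagonal coefficients to the left of `p`. -/
def leftDiag (i : ℕ) : ℝ := b (p - i)

/-- The characteristic polynomial of the part of the box to the right of `p`. -/
def rightPoly : Polynomial ℝ := jacobiPoly (rightOff a p) (rightDiag b p) n 1

/-- The characteristic polynomial of the part of the box to the left of `p`. -/
def leftPoly : Polynomial ℝ := jacobiPoly (leftOff a p) (leftDiag b p) n 1

/-- The solution of the eigenvalue equation in the box away from `p`, with Dirichlet boundary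
conditions, normalized to be `1` at `p`. -/
def boxSol (E : ℝ) (i : ℤ) : ℝ :=
  if p ≤ i then halfSol (rightOff a p) (rightDiag b p) n E (i - p).toNat
  else halfSol (leftOff a p) (leftDiag b p) n E (p - i).toNat

/-- The value of `b p` for which `E` is an eigenvalue of the box matrix. -/
def pivotVal (E : ℝ) : ℝ :=
  E - a p * halfSol (rightOff a p) (rightDiag b p) n E 1
    - a (p - 1) * halfSol (leftOff a p) (leftDiag b p) n E 1

variable {a b p n} {E : ℝ}

theorem boxSol_add (i : ℕ) :
    boxSol a b p n E (p + i) = halfSol (rightOff a p) (rightDiag b p) n E i := by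
  simp [boxSol]

theorem boxSol_sub (hR : (rightPoly a b p n).eval E ≠ 0) (hL : (leftPoly a b p n).eval E ≠ 0)
    (i : ℕ) : boxSol a b p n E (p - i) = halfSol (leftOff a p) (leftDiag b p) n E i := by
  cases i with
  | zero =>
    have := boxSol_add (a := a) (b := b) (p := p) (n := n) (E := E) 0
    simp only [Nat.cast_zero, add_zero, sub_zero] at this ⊢
    rw [this, halfSol_zero hR, halfSol_zero hL]
  | succ i =>
    have h : ¬ p ≤ p - ((i + 1 : ℕ) : ℤ) := by push_cast; omega
    rw [boxSol, if_neg h]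
    congr 1
    omega

/-- The glued solution fails the eigenvalue equation only at p, and the defect measures how far b p
is from `pivotVal`. -/
theorem boxSol_eq (hR : (rightPoly a b p n).eval E ≠ 0) (hL : (leftPoly a b p n).eval E ≠ 0)
    {i : ℤ} (hi : i ∈ Finset.Icc (p - n : ℤ) (p + n)) :
    a i * boxSol a b p n E (i + 1) + a (i - 1) * boxSol a b p n E (i - 1)
      + b i * boxSol a b p n E i
      = E * boxSol a b p n E i + if i = p then b p - pivotVal a b p n E else 0 := by
  have hi' := Finset.mem_Icc.1 hi
  rcases lt_trichotomy i p with h | h | h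
  · obtain ⟨k, hk⟩ : ∃ k : ℕ, i = p - ((k + 1 : ℕ) : ℤ) :=
      ⟨(p - i - 1).toNat, by push_cast; omega⟩
    have e1 : i + 1 = p - (k : ℤ) := by rw [hk]; push_cast; ring
    have e2 : i - 1 = p - ((k + 2 : ℕ) : ℤ) := by rw [hk]; push_cast; ring
    have hs := halfSol_eq (α := leftOff a p) (β := leftDiag b p) (E := E) (n := n) k (by omega)
    have c1 : leftOff a p (k + 1) = a (i - 1) := by rw [leftOff, hk]
    have c2 : leftOff a p k = a i := by rw [leftOff, hk]; congr 1; push_cast; ring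
    have c3 : leftDiag b p (k + 1) = b i := by rw [leftDiag, hk]
    rw [c1, c2, c3] at hs
    rw [if_neg h.ne, e1, e2, boxSol_sub hR hL, boxSol_sub hR hL, ← e2]
    rw [show boxSol a b p n E i = _ from hk ▸ boxSol_sub hR hL (k + 1)]
    linarith
  · subst h
    have e1 : boxSol a b i n E (i + 1) = _ := boxSol_add (a := a) (b := b) (p := i) (n := n) 1
    have e2 : boxSol a b i n E (i - 1) = _ := boxSol_sub hR hL 1
    have e3 : boxSol a b i n E i = 1 := by
      have := boxSol_add (a := a) (b := b) (p := i) (n := n) (E := E) 0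
      rw [halfSol_zero hR] at this
      simpa using this
    rw [if_pos rfl, e1, e2, e3, pivotVal]
    ring
  · obtain ⟨k, hk⟩ : ∃ k : ℕ, i = p + ((k + 1 : ℕ) : ℤ) :=
      ⟨(i - p - 1).toNat, by push_cast; omega⟩
    have e1 : i - 1 = p + (k : ℤ) := by rw [hk]; push_cast; ring
    have e2 : i + 1 = p + ((k + 2 : ℕ) : ℤ) := by rw [hk]; push_cast; ring
    have hs := halfSol_eq (α := rightOff a p) (β := rightDiag b p) (E := E) (n := n) k (by omega)
    have c1 : rightOff a p (k + 1) = a i := by rw [rightOff, hk]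
    have c2 : rightOff a p k = a (i - 1) := by rw [rightOff, e1]
    have c3 : rightDiag b p (k + 1) = b i := by rw [rightDiag, hk]
    rw [c1, c2, c3] at hs
    rw [if_neg h.ne', e1, e2, boxSol_add, boxSol_add, ← e1]
    rw [show boxSol a b p n E i = _ from hk ▸ boxSol_add (k + 1)]
    linarith

theorem continuousAt_boxSol (hR : (rightPoly a b p n).eval E ≠ 0)
    (hL : (leftPoly a b p n).eval E ≠ 0) (i : ℤ) :
    ContinuousAt (fun E => boxSol a b p n E i) E := by
  unfold boxSol
  split_ifs
  · exact continuousAt_halfSol hR _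
  · exact continuousAt_halfSol hL _

/-- The centre of a box, as a point of the box. -/
def boxCenter (p : ℤ) (n : ℕ) : Box p n := ⟨p, by simp⟩

theorem boxEigvec_eq_boxSol (ha : ∀ i, 0 < a i) {k : Box p n}
    (hk : boxEigvec a b p n k (boxCenter p n) ≠ 0) :
    (rightPoly a b p n).eval (boxEigval a b p n k) ≠ 0 ∧
    (leftPoly a b p n).eval (boxEigval a b p n k) ≠ 0 ∧
    ∀ i : Box p n, boxEigvec a b p n k i = boxEigvec a b p n k (boxCenter p n)
      * boxSol a b p n (boxEigval a b p n k) i := by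
  set φ := boxEigvec a b p n k with hφ
  set lam := boxEigval a b p n k
  have h0 : boxExtend φ p = φ (boxCenter p n) := boxExtend_coe φ (boxCenter p n)
  have heq : ∀ i ∈ Finset.Icc (p - n : ℤ) (p + n), a i * boxExtend φ (i + 1)
      + a (i - 1) * boxExtend φ (i - 1) + b i * boxExtend φ i = lam * boxExtend φ i := by
    intro i hi
    have h := congrFun (boxMatrix_mulVec_boxEigvec a b p n k) ⟨i, hi⟩
    rw [boxMatrix_mulVec_apply] at h
    simp only [Pi.smul_apply, smul_eq_mul] at h
    rw [show boxExtend φ i = φ ⟨i, hi⟩ from boxExtend_coe φ ⟨i, hi⟩]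
    exact h
  have hright := solution_eq_halfSol (α := rightOff a p) (β := rightDiag b p) (E := lam) (n := n)
    (fun i => ha _) (u := fun i : ℕ => boxExtend φ (p + i))
    (boxExtend_of_notMem φ (by simp)) (fun i hi => by
      have h := heq (p + ((i + 1 : ℕ) : ℤ)) (by rw [Finset.mem_Icc]; push_cast; omega)
      have e1 : p + ((i + 1 : ℕ) : ℤ) + 1 = p + ((i + 2 : ℕ) : ℤ) := by push_cast; ring
      have e2 : p + ((i + 1 : ℕ) : ℤ) - 1 = p + (i : ℤ) := by push_cast; ring
      rwa [e1, e2] at h) (by simpa [h0] using hk)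
  have hleft := solution_eq_halfSol (α := leftOff a p) (β := leftDiag b p) (E := lam) (n := n)
    (fun i => ha _) (u := fun i : ℕ => boxExtend φ (p - i))
    (boxExtend_of_notMem φ (by simp; omega)) (fun i hi => by
      have h := heq (p - ((i + 1 : ℕ) : ℤ)) (by rw [Finset.mem_Icc]; push_cast; omega)
      have e1 : p - ((i + 1 : ℕ) : ℤ) + 1 = p - (i : ℤ) := by push_cast; ring
      have e2 : p - ((i + 1 : ℕ) : ℤ) - 1 = p - ((i + 2 : ℕ) : ℤ) := by push_cast; ring
      have e3 : leftOff a p i = a (p - ((i + 1 : ℕ) : ℤ)) := by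
        rw [leftOff]; congr 1; push_cast; ring
      rw [e1, e2, ← e3, ← e2] at h
      rw [← h, e2]
      simp only [leftOff, leftDiag]
      rw [e2]
      ring) (by simpa [h0] using hk)
  refine ⟨hright.1, hleft.1, fun i => ?_⟩
  have hi := Finset.mem_Icc.1 i.2
  rw [← boxExtend_coe φ i]
  by_cases h : p ≤ i
  · obtain ⟨j, hj⟩ : ∃ j : ℕ, (i : ℤ) = p + j := ⟨(i - p : ℤ).toNat, by omega⟩
    have := hright.2 j (by omega)
    simp only [Nat.cast_zero, add_zero, h0] at this
    rw [hj, this, boxSol_add]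
  · obtain ⟨j, hj⟩ : ∃ j : ℕ, (i : ℤ) = p - j := ⟨(p - i : ℤ).toNat, by omega⟩
    have := hleft.2 j (by omega)
    simp only [Nat.cast_zero, sub_zero, h0] at this
    rw [hj, this, boxSol_sub hright.1 hleft.1]

/-- Pair the defect equation for `boxSol` with the k-th eigenvector, using the symmetry of the
matrix. This exhibits the zero of `pivotVal - b p` at the eigenvalue as an explicit linear factor,
so no derivative is needed. -/
theorem pivotVal_sub_mul (k : Box p n) (hR : (rightPoly a b p n).eval E ≠ 0)
    (hL : (leftPoly a b p n).eval E ≠ 0) :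
    (pivotVal a b p n E - b p) * boxEigvec a b p n k (boxCenter p n)
      = (E - boxEigval a b p n k) * ∑ i, boxEigvec a b p n k i * boxSol a b p n E i := by
  set φ := boxEigvec a b p n k
  have h1 : (boxMatrix a b p n).mulVec (fun j => boxSol a b p n E j)
      = fun i : Box p n => E * boxSol a b p n E i
        + if (i : ℤ) = p then b p - pivotVal a b p n E else 0 := by
    funext i
    rw [boxMatrix_mulVec _ _ _ _ _ _ _ i, boxSol_eq hR hL i.2]
    · have := boxSol_add (a := a) (b := b) (p := p) (n := n) (E := E) (n + 1)
      rw [halfSol_of_lt (by omega)] at this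
      rw [← this]; congr 1; push_cast; ring
    · have := boxSol_sub hR hL (n + 1)
      rw [halfSol_of_lt (by omega)] at this
      rw [← this]; congr 1; push_cast; ring
  have h2 : φ ⬝ᵥ (boxMatrix a b p n).mulVec (fun j => boxSol a b p n E j)
      = (boxMatrix a b p n).mulVec φ ⬝ᵥ (fun j => boxSol a b p n E j) := by
    rw [Matrix.dotProduct_mulVec, ← Matrix.mulVec_transpose]
    congr 2
    exact (boxMatrix_isHermitian a b p n).eq
  rw [h1, boxMatrix_mulVec_boxEigvec] at h2
  simp only [dotProduct, mul_add, Finset.sum_add_distrib, Pi.smul_apply, smul_eq_mul] at h2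
  have h3 : ∑ i : Box p n, φ i * (if (i : ℤ) = p then b p - pivotVal a b p n E else 0)
      = φ (boxCenter p n) * (b p - pivotVal a b p n E) := by
    rw [Finset.sum_eq_single (boxCenter p n)]
    · simp [boxCenter]
    · intro i _ hi
      rw [if_neg, mul_zero]
      exact fun h => hi (Subtype.ext h)
    · simp
  rw [h3] at h2
  have h4 : ∑ i : Box p n, φ i * (E * boxSol a b p n E i)
      = E * ∑ i : Box p n, φ i * boxSol a b p n E i := by
    rw [Finset.mul_sum]; exact Finset.sum_congr rfl fun i _ => by ring
  have h5 : ∑ i : Box p n, boxEigval a b p n k * φ i * boxSol a b p n E i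
      = boxEigval a b p n k * ∑ i : Box p n, φ i * boxSol a b p n E i := by
    rw [Finset.mul_sum]; exact Finset.sum_congr rfl fun i _ => by ring
  rw [h4, h5] at h2
  linarith

/-- At the k-th eigenvalue `boxSol` is φ_k / φ_k(p), so this is orthonormality. With
`pivotVal_sub_mul` it gives the slope 1/φ_k(p)² at the zero. -/
theorem sum_boxEigvec_mul_boxSol (ha : ∀ i, 0 < a i) {k : Box p n}
    (hk : boxEigvec a b p n k (boxCenter p n) ≠ 0) (l : Box p n) :
    ∑ i, boxEigvec a b p n l i * boxSol a b p n (boxEigval a b p n k) i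
      = (if l = k then 1 else 0) / boxEigvec a b p n k (boxCenter p n) := by
  rw [eq_div_iff hk, ← sum_boxEigvec_mul a b p n l k, Finset.sum_mul]
  refine Finset.sum_congr rfl fun i _ => ?_
  rw [(boxEigvec_eq_boxSol ha hk).2.2 i]
  ring

theorem boxEigval_injOn (ha : ∀ i, 0 < a i) {k l : Box p n}
    (hk : boxEigvec a b p n k (boxCenter p n) ≠ 0) (hl : boxEigvec a b p n l (boxCenter p n) ≠ 0)
    (h : boxEigval a b p n k = boxEigval a b p n l) : k = l := by
  by_contra hne
  have h1 := sum_boxEigvec_mul_boxSol ha hk k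
  have h2 := sum_boxEigvec_mul_boxSol ha hl k
  rw [if_pos rfl, h] at h1
  rw [if_neg hne, h1] at h2
  simp [hk] at h2

end

/-! ### The correlator as an energy integral against an approximate delta function. -/

open Filter Topology

/-- The normalized indicator function of `[-ε, ε]`. -/
def bump (ε z : ℝ) : ℝ≥0∞ := if |z| ≤ ε then ENNReal.ofReal (2 * ε)⁻¹ else 0

theorem measurable_bump (ε : ℝ) : Measurable (bump ε) :=
  Measurable.ite (measurableSet_le (by fun_prop) measurable_const) measurable_const
    measurable_const

/-- The mass of `w(E) δ(z(E)) dE` near a simple zero of `z` is `w / z'`. -/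
theorem ofReal_le_liminf_lintegral_bump {w z g : ℝ → ℝ} {x : ℝ} (hw : ContinuousAt w x)
    (hg : ContinuousAt g x) (hgx : 0 < g x) (hz : ∀ᶠ E in 𝓝 x, z E = (E - x) * g E) {U : Set ℝ}
    (hU : U ∈ 𝓝 x) {ε : ℕ → ℝ} (hε : ∀ j, 0 < ε j) (hε0 : Tendsto ε atTop (𝓝 0)) :
    ENNReal.ofReal (w x / g x)
      ≤ liminf (fun j => ∫⁻ E in U, ENNReal.ofReal (w E) * bump (ε j) (z E)) atTop := by
  refine le_of_forall_lt_imp_le_of_dense fun c hc => ?_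
  obtain ⟨c', hc', hlt, hlt'⟩ := ENNReal.lt_iff_exists_real_btwn.1 hc
  refine hlt.le.trans ?_
  have hlt2 : c' < w x / g x := (ENNReal.ofReal_lt_ofReal_iff_of_nonneg hc').1 hlt'
  have hcont : ContinuousAt (fun η : ℝ => (w x - η) / (g x + η)) 0 :=
    ContinuousAt.div (by fun_prop) (by fun_prop) (by simpa using hgx.ne')
  have hev : ∀ᶠ η in 𝓝[>] (0 : ℝ), c' < (w x - η) / (g x + η) :=
    (hcont.eventually_const_lt (by simpa using hlt2)).filter_mono nhdsWithin_le_nhds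
  obtain ⟨η, hη, hη0⟩ := (hev.and self_mem_nhdsWithin).exists
  have hη0' : 0 < η := hη0
  have hgη : 0 < g x + η := by linarith
  have hwη : 0 ≤ w x - η := by
    rw [lt_div_iff₀ hgη] at hη
    nlinarith
  have hnear : ∀ᶠ E in 𝓝 x, (w x - η < w E ∧ 0 < g E ∧ g E < g x + η) ∧ z E = (E - x) * g E ∧
      E ∈ U := by
    filter_upwards [hw.eventually_const_lt (by linarith : w x - η < w x),
      hg.eventually_const_lt hgx, hg.eventually_lt_const (by linarith : g x < g x + η), hz, hU]
      with E h1 h2 h3 h4 h5 using ⟨⟨h1, h2, h3⟩, h4, h5⟩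
  obtain ⟨ρ, hρ0, hρ⟩ := Metric.eventually_nhds_iff.1 hnear
  refine le_liminf_of_le (by isBoundedDefault) ?_
  have hsmall : ∀ᶠ j in atTop, ε j / (g x + η) < ρ := by
    have : Tendsto (fun j => ε j / (g x + η)) atTop (𝓝 0) := by simpa using hε0.div_const _
    exact this.eventually_lt_const hρ0
  filter_upwards [hsmall] with j hj
  -- On this interval |z| ≤ ε j, so the bump takes its full height 1/(2ε j). Multiplied by the
  -- length 2l and by w x - η, this gives (w x - η)/(g x + η).
  set l := ε j / (g x + η) with hl
  have hl0 : 0 < l := div_pos (hε j) hgη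
  have hsub : ∀ E ∈ Icc (x - l) (x + l), |E - x| ≤ l := fun E hE =>
    abs_le.2 ⟨by linarith [hE.1], by linarith [hE.2]⟩
  have hsub' : ∀ E ∈ Icc (x - l) (x + l), dist E x < ρ := fun E hE =>
    (hsub E hE).trans_lt hj
  calc ENNReal.ofReal c' ≤ ENNReal.ofReal ((w x - η) / (g x + η)) := ENNReal.ofReal_le_ofReal hη.le
    _ = ENNReal.ofReal (w x - η) * ENNReal.ofReal (2 * ε j)⁻¹ * volume (Icc (x - l) (x + l)) := by
        rw [Real.volume_Icc, ← ENNReal.ofReal_mul hwη, ← ENNReal.ofReal_mul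
          (mul_nonneg hwη (inv_nonneg.2 (by linarith [hε j])))]
        congr 1
        have := (hε j).ne'
        rw [hl]
        field_simp
        ring
    _ = ∫⁻ E in Icc (x - l) (x + l), ENNReal.ofReal (w x - η) * ENNReal.ofReal (2 * ε j)⁻¹ := by
        rw [setLIntegral_const]
    _ ≤ ∫⁻ E in Icc (x - l) (x + l), ENNReal.ofReal (w E) * bump (ε j) (z E) := by
        refine setLIntegral_mono' measurableSet_Icc fun E hE => ?_
        obtain ⟨⟨h1, h2, h3⟩, h4, -⟩ := hρ (hsub' E hE)
        refine mul_le_mul' (ENNReal.ofReal_le_ofReal h1.le) ?_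
        rw [bump, if_pos]
        rw [h4, abs_mul, abs_of_pos h2]
        calc |E - x| * g E ≤ l * (g x + η) := by gcongr; exact hsub E hE
          _ = ε j := div_mul_cancel₀ _ hgη.ne'
    _ ≤ _ := lintegral_mono_set fun E hE => (hρ (hsub' E hE)).2.2

/-- Fatou's lemma for counting measure. -/
theorem sum_liminf_le_liminf_sum {ι : Type*} [Fintype ι] (f : ℕ → ι → ℝ≥0∞) :
    ∑ k, liminf (fun j => f j k) atTop ≤ liminf (fun j => ∑ k, f j k) atTop := by
  let _ : MeasurableSpace ι := ⊤
  have h := lintegral_liminf_le (μ := Measure.count) (u := atTop) (f := f)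
    (fun j => measurable_from_top)
  simpa only [lintegral_count, tsum_fintype] using h

/-- The smoothed Kunz–Souillard density of the eigenfunction correlator. -/
def ksDensity (a b : ℤ → ℝ) (p : ℤ) (n m : ℕ) (ε E : ℝ) : ℝ≥0∞ :=
  (∏ j ∈ Finset.range m,
    ENNReal.ofReal (rightOff a p j / |contFrac (rightOff a p) (rightDiag b p) E (n - j) (j + 1)|)) *
  bump ε (E - rightOff a p 0 ^ 2 / contFrac (rightOff a p) (rightDiag b p) E n 1
    - leftOff a p 0 ^ 2 / contFrac (leftOff a p) (leftDiag b p) E n 1 - b p)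

/-- The continued-fraction form suits averaging over the sites, the solution form suits analysis in
E. They agree off the zeros of the polynomials. -/
theorem ksDensity_ae_eq {a b : ℤ → ℝ} (ha : ∀ i, 0 < a i) (p : ℤ) {n m : ℕ} (hm : m ≤ n) (ε : ℝ) :
    ∀ᵐ E, ksDensity a b p n m ε E = ENNReal.ofReal |boxSol a b p n E (p + m)|
      * bump ε (pivotVal a b p n E - b p) := by
  filter_upwards [ae_eval_jacobiPoly_ne_zero (rightOff a p) (rightDiag b p),
    ae_eval_jacobiPoly_ne_zero (leftOff a p) (leftDiag b p)] with E hR hL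
  have h1 := mul_halfSol_one (n := n) hR
  have h2 := mul_halfSol_one (n := n) hL
  have h3 := abs_halfSol_eq hR (fun i => ha _) hm
  rw [ksDensity, ← h1, ← h2, pivotVal, boxSol_add, h3, ENNReal.ofReal_prod_of_nonneg]
  · simp [rightOff, leftOff]
  · intro j _
    exact div_nonneg (ha _).le (abs_nonneg _)

/-- Since φ_k(x) = φ_k(p) u(x), the term |φ_k(p) φ_k(x)| equals φ_k(p)² |u(x)|, which is w / z' at
the simple zero E_k of z. Integrals over disjoint neighbourhoods of these zeros add up, and
eigenvectors vanishing at p contribute nothing to the correlator. -/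
theorem boxCorrelator_le_liminf {a b : ℤ → ℝ} (ha : ∀ i, 0 < a i) {p : ℤ} {n m : ℕ} (hm : m ≤ n)
    {R : ℝ} (hR : ∀ k, |boxEigval a b p n k| < R) {x : Box p n} (hx : (x : ℤ) = p + m)
    {ε : ℕ → ℝ} (hε : ∀ j, 0 < ε j) (hε0 : Tendsto ε atTop (𝓝 0)) :
    ENNReal.ofReal (boxCorrelator a b p n (boxCenter p n) x)
      ≤ liminf (fun j => ∫⁻ E in Icc (-R) R, ksDensity a b p n m (ε j) E) atTop := by
  classical
  set S := {k : Box p n // boxEigvec a b p n k (boxCenter p n) ≠ 0}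
  set w : ℝ → ℝ := fun E => |boxSol a b p n E (p + m)|
  set z : ℝ → ℝ := fun E => pivotVal a b p n E - b p
  set g : S → ℝ → ℝ := fun k E =>
    (∑ i, boxEigvec a b p n k i * boxSol a b p n E i) / boxEigvec a b p n k (boxCenter p n)
  have hinj : Function.Injective fun k : S => boxEigval a b p n k := fun k l h =>
    Subtype.ext (boxEigval_injOn ha k.2 l.2 h)
  obtain ⟨U, hU, hdisj⟩ := (Set.finite_range fun k : S => boxEigval a b p n k).t2_separation
  set V : S → Set ℝ := fun k => U (boxEigval a b p n k) ∩ Ioo (-R) R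
  have hVn : ∀ k : S, V k ∈ 𝓝 (boxEigval a b p n k) := fun k =>
    inter_mem ((hU _).2.mem_nhds (hU _).1) (Ioo_mem_nhds (abs_lt.1 (hR k)).1 (abs_lt.1 (hR k)).2)
  have hVm : ∀ k, MeasurableSet (V k) := fun k => (hU _).2.measurableSet.inter measurableSet_Ioo
  have hVd : Pairwise (Function.onFun Disjoint V) := fun k l hkl =>
    (hdisj (mem_range_self k) (mem_range_self l) (hinj.ne hkl)).mono inter_subset_left
      inter_subset_left
  have hVs : (⋃ k, V k) ⊆ Icc (-R) R := iUnion_subset fun k =>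
    inter_subset_right.trans Ioo_subset_Icc_self
  have hval : ∀ k : S, ENNReal.ofReal |boxEigvec a b p n k (boxCenter p n) * boxEigvec a b p n k x|
      = ENNReal.ofReal (w (boxEigval a b p n k) / g k (boxEigval a b p n k)) := by
    intro k
    have hk := k.2
    have h1 := (boxEigvec_eq_boxSol ha hk).2.2 x
    have h2 := sum_boxEigvec_mul_boxSol ha hk k
    simp only [g, w, h2, if_true]
    rw [h1, hx]
    congr 1
    rw [div_div, one_div, div_inv_eq_mul, ← mul_assoc, abs_mul, abs_mul_self, mul_comm]
  have hloc : ∀ k : S, ENNReal.ofReal |boxEigvec a b p n k (boxCenter p n) * boxEigvec a b p n k x|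
      ≤ liminf (fun j => ∫⁻ E in V k, ENNReal.ofReal (w E) * bump (ε j) (z E)) atTop := by
    intro k
    have hk := k.2
    obtain ⟨hDR, hDL, -⟩ := boxEigvec_eq_boxSol ha hk
    rw [hval]
    refine ofReal_le_liminf_lintegral_bump ?_ ?_ ?_ ?_ (hVn k) hε hε0
    · exact (continuousAt_boxSol hDR hDL _).abs
    · refine ContinuousAt.div_const ?_ _
      exact tendsto_finsetSum _ fun i _ =>
        continuousAt_const.mul (continuousAt_boxSol hDR hDL _)
    · simp only [g, sum_boxEigvec_mul_boxSol ha hk, if_true]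
      rw [div_div, one_div]
      exact inv_pos.2 (mul_self_pos.2 hk)
    · filter_upwards [(rightPoly a b p n).continuous.continuousAt.eventually_ne hDR,
        (leftPoly a b p n).continuous.continuousAt.eventually_ne hDL] with E h1 h2
      have := pivotVal_sub_mul (k : Box p n) h1 h2
      simp only [g, z]
      rw [mul_div_assoc', eq_div_iff hk, this]
  have hrew : ∀ j, ∫⁻ E in Icc (-R) R, ksDensity a b p n m (ε j) E
      = ∫⁻ E in Icc (-R) R, ENNReal.ofReal (w E) * bump (ε j) (z E) := fun j =>
    lintegral_congr_ae (ae_restrict_of_ae (ksDensity_ae_eq ha p hm (ε j)))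
  simp only [hrew]
  calc ENNReal.ofReal (boxCorrelator a b p n (boxCenter p n) x)
      = ∑ k, ENNReal.ofReal |boxEigvec a b p n k (boxCenter p n) * boxEigvec a b p n k x| :=
        ENNReal.ofReal_sum_of_nonneg fun k _ => abs_nonneg _
    _ = ∑ k : S, ENNReal.ofReal
          |boxEigvec a b p n k (boxCenter p n) * boxEigvec a b p n k x| := by
        refine (Finset.sum_filter_of_ne (p := fun k =>
          boxEigvec a b p n k (boxCenter p n) ≠ 0) fun k _ hne h0 => hne ?_).symm.trans
          (Finset.sum_subtype _ (by simp) _)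
        simp [h0]
    _ ≤ ∑ k : S, liminf (fun j => ∫⁻ E in V k, ENNReal.ofReal (w E) * bump (ε j) (z E)) atTop :=
        Finset.sum_le_sum fun k _ => hloc k
    _ ≤ liminf (fun j => ∑ k : S, ∫⁻ E in V k, ENNReal.ofReal (w E) * bump (ε j) (z E)) atTop :=
        sum_liminf_le_liminf_sum _
    _ ≤ _ := by
        refine liminf_le_liminf (Eventually.of_forall fun j => ?_)
        exact ((tsum_fintype (L := SummationFilter.unconditional S) _).symm.trans
          (lintegral_iUnion hVm hVd _).symm).le.trans (lintegral_mono_set hVs)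

/-! ### From finite boxes to the evolution on the whole lattice. -/

section

variable (a b : ℤ → ℝ) (p : ℤ) (n : ℕ)

/-- The eigenvectors of a box, extended by zero. -/
def extEigvec (k : Box p n) (i : ℤ) : ℝ := boxExtend (boxEigvec a b p n k) i

/-- The eigenfunction correlator of a box, for sites in `ℤ`. -/
def extCorrelator (x y : ℤ) : ℝ := ∑ k, |extEigvec a b p n k x * extEigvec a b p n k y|

variable {a b p n}

theorem extCorrelator_coe (x y : Box p n) :
    extCorrelator a b p n x y = boxCorrelator a b p n x y := by
  simp only [extCorrelator, extEigvec, boxExtend_coe, boxCorrelator]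

theorem extCorrelator_comm (x y : ℤ) :
    extCorrelator a b p n x y = extCorrelator a b p n y x := by
  simp only [extCorrelator, mul_comm]

theorem extCorrelator_le_one (x y : ℤ) : extCorrelator a b p n x y ≤ 1 := by
  by_cases hx : x ∈ Finset.Icc (p - n : ℤ) (p + n)
  · by_cases hy : y ∈ Finset.Icc (p - n : ℤ) (p + n)
    · exact (extCorrelator_coe ⟨x, hx⟩ ⟨y, hy⟩).le.trans (boxCorrelator_le_one _ _ _ _ _ _)
    · simp [extCorrelator, extEigvec, boxExtend_of_notMem _ hy]
  · simp [extCorrelator, extEigvec, boxExtend_of_notMem _ hx]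

end

theorem delta_apply (y x : ℤ) : delta y x = if x = y then 1 else 0 := by
  rw [delta, lp.single_apply, Pi.single_apply]

theorem inner_delta (x : ℤ) (f : ell2Z) : inner ℂ (delta x) f = f x := by
  rw [delta, lp.inner_single_left]
  simp

/-- Finite propagation: each factor moves by at most one site, so a path of m steps ending at x
stays in the box when x is at distance at least m from its ends. -/
theorem jacobi_pow_delta_apply (a b : ellInftyZ) {p : ℤ} {n : ℕ} (y : Box p n) (m : ℕ)
    (x : Box p n) (hx : |(x : ℤ) - p| + m ≤ n) :
    (jacobi a b ^ m) (delta y) x = ((boxMatrix (fun i => a i) (fun i => b i) p n ^ m) x y : ℝ) := by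
  induction m generalizing x with
  | zero =>
    simp only [pow_zero, one_apply_eq_self, delta_apply, Matrix.one_apply,
      Subtype.ext_iff]
    split_ifs <;> simp
  | succ m ih =>
    push_cast at hx
    have hx' := abs_le.1 (show |(x : ℤ) - p| ≤ n - (m + 1) by linarith)
    have h1 : (x : ℤ) + 1 ∈ Finset.Icc (p - n : ℤ) (p + n) := by rw [Finset.mem_Icc]; omega
    have h2 : (x : ℤ) - 1 ∈ Finset.Icc (p - n : ℤ) (p + n) := by rw [Finset.mem_Icc]; omega
    have i0 := ih x (by linarith)
    have i1 := ih ⟨x + 1, h1⟩ (by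
      have := abs_le.2 (show -((n : ℤ) - m) ≤ x + 1 - p ∧ x + 1 - p ≤ (n : ℤ) - m by omega)
      simpa using by linarith)
    have i2 := ih ⟨x - 1, h2⟩ (by
      have := abs_le.2 (show -((n : ℤ) - m) ≤ x - 1 - p ∧ x - 1 - p ≤ (n : ℤ) - m by omega)
      simpa using by linarith)
    rw [pow_succ', mul_apply_eq_comp, jacobi_apply, i0]
    have hA : (boxMatrix (fun i => a i) (fun i => b i) p n ^ (m + 1)) x y
        = (boxMatrix (fun i => a i) (fun i => b i) p n).mulVec
          (fun j => (boxMatrix (fun i => a i) (fun i => b i) p n ^ m) j y) x := by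
      rw [pow_succ', Matrix.mul_apply]; rfl
    have e1 := boxExtend_coe
      (fun j => (boxMatrix (fun i => a i) (fun i => b i) p n ^ m) j y) ⟨x + 1, h1⟩
    have e2 := boxExtend_coe
      (fun j => (boxMatrix (fun i => a i) (fun i => b i) p n ^ m) j y) ⟨x - 1, h2⟩
    simp only at e1 e2 i1 i2
    rw [hA, boxMatrix_mulVec_apply, e1, e2, i1, i2]
    push_cast
    ring

theorem hasSum_evolution_delta (J : ell2Z →L[ℂ] ell2Z) (t : ℝ) (x y : ℤ) :
    HasSum (fun m : ℕ => ((m.factorial : ℂ)⁻¹ * (-(Complex.I * t)) ^ m) * (J ^ m) (delta y) x)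
      (inner ℂ (delta x) (evolution J t (delta y))) := by
  have h := NormedSpace.exp_series_hasSum_exp' (𝕂 := ℂ) ((-(Complex.I * (t : ℂ))) • J)
  have h2 := (h.mapL (ContinuousLinearMap.apply ℂ ell2Z (delta y))).mapL
    (innerSL ℂ (delta x))
  refine h2.congr_fun fun m => ?_
  simp only [smul_pow, ContinuousLinearMap.apply_apply, innerSL_apply_apply, map_smul,
    inner_delta, smul_eq_mul]
  ring

/-- The transition amplitude is bounded by the eigenfunction correlators of large boxes. -/
theorem enorm_inner_evolution_le (a b : ellInftyZ) (p x y : ℤ) (t : ℝ) :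
    ‖inner ℂ (delta x) (evolution (jacobi a b) t (delta y))‖ₑ
      ≤ liminf (fun n : ℕ => ENNReal.ofReal
        (extCorrelator (fun i => a i) (fun i => b i) p n x y)) atTop := by
  set a' : ℤ → ℝ := fun i => a i
  set b' : ℤ → ℝ := fun i => b i
  set c : ℕ → ℂ := fun m => (m.factorial : ℂ)⁻¹ * (-(Complex.I * t)) ^ m
  set P : ℕ → ℕ → ℝ := fun n m => ∑ k, boxEigval a' b' p n k ^ m *
    (extEigvec a' b' p n k x * extEigvec a' b' p n k y) with hP
  -- For boxes containing x and y, this is the transition amplitude of the box matrix; P n m is its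
  -- m-th moment.
  set Z : ℕ → ℂ := fun n => ∑ k, Complex.exp (-(Complex.I * t) * boxEigval a' b' p n k) *
    (extEigvec a' b' p n k x * extEigvec a' b' p n k y : ℝ)
  have hZ : ∀ n, HasSum (fun m => c m * (P n m : ℂ)) (Z n) := by
    intro n
    have h : ∀ k, HasSum (fun m : ℕ => c m * (boxEigval a' b' p n k : ℂ) ^ m *
        (extEigvec a' b' p n k x * extEigvec a' b' p n k y : ℝ))
        (Complex.exp (-(Complex.I * t) * boxEigval a' b' p n k) *
        (extEigvec a' b' p n k x * extEigvec a' b' p n k y : ℝ)) := by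
      intro k
      refine HasSum.mul_right _ ?_
      have h := NormedSpace.exp_series_hasSum_exp' (𝕂 := ℂ)
        (-(Complex.I * t) * boxEigval a' b' p n k : ℂ)
      rw [Complex.exp_eq_exp_ℂ]
      refine h.congr_fun fun m => ?_
      rw [smul_eq_mul, mul_pow, mul_assoc]
    refine (hasSum_sum fun k _ => h k).congr_fun fun m => ?_
    simp only [hP]
    push_cast
    rw [Finset.mul_sum]
    exact Finset.sum_congr rfl fun k _ => by ring
  have hZn : ∀ n, ‖Z n‖ₑ ≤ ENNReal.ofReal (extCorrelator a' b' p n x y) := by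
    intro n
    rw [← ofReal_norm]
    refine ENNReal.ofReal_le_ofReal ((norm_sum_le _ _).trans (Finset.sum_le_sum fun k _ => ?_))
    rw [norm_mul, Complex.norm_real, Real.norm_eq_abs,
      show -(Complex.I * t) * boxEigval a' b' p n k
        = ((-(t * boxEigval a' b' p n k) : ℝ) : ℂ) * Complex.I by push_cast; ring,
      Complex.norm_exp_ofReal_mul_I, one_mul]
  set R : ℝ := 2 * ‖a‖ + ‖b‖
  have hR0 : 0 ≤ R := by positivity
  have hPb : ∀ n m, |P n m| ≤ R ^ m := by
    intro n m
    calc |P n m| ≤ ∑ k, R ^ m * |extEigvec a' b' p n k x * extEigvec a' b' p n k y| := by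
          refine (Finset.abs_sum_le_sum_abs _ _).trans (Finset.sum_le_sum fun k _ => ?_)
          rw [abs_mul, abs_pow]
          gcongr
          exact abs_boxEigval_le a' b' p n (abs_le_norm a) (abs_le_norm b) k
      _ = R ^ m * extCorrelator a' b' p n x y := by rw [← Finset.mul_sum]; rfl
      _ ≤ R ^ m * 1 := by gcongr; exact extCorrelator_le_one x y
      _ = R ^ m := mul_one _
  have hlim : Tendsto Z atTop (𝓝 (inner ℂ (delta x) (evolution (jacobi a b) t (delta y)))) := by
    have hs := hasSum_evolution_delta (jacobi a b) t x y
    have hZf : Z = fun n => ∑' m, c m * (P n m : ℂ) := funext fun n => (hZ n).tsum_eq.symm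
    rw [← hs.tsum_eq, hZf]
    -- Each term of the exponential series is eventually constant in n by finite propagation, and
    -- the uniform spectral bound R dominates the series.
    refine tendsto_tsum_of_dominated_convergence
      (bound := fun m => (|t| * R) ^ m / m.factorial) (Real.summable_pow_div_factorial _) ?_ ?_
    · intro m
      refine tendsto_const_nhds.congr' ?_
      filter_upwards [eventually_ge_atTop ((|x - p| + |y - p| + m).toNat)] with n hn
      have hn' : |x - p| + |y - p| + m ≤ (n : ℤ) := by omega
      have hx : x ∈ Finset.Icc (p - n : ℤ) (p + n) := by
        rw [Finset.mem_Icc]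
        have := abs_le.1 (show |x - p| ≤ (n : ℤ) by linarith [abs_nonneg (y - p)])
        omega
      have hy : y ∈ Finset.Icc (p - n : ℤ) (p + n) := by
        rw [Finset.mem_Icc]
        have := abs_le.1 (show |y - p| ≤ (n : ℤ) by linarith [abs_nonneg (x - p)])
        omega
      have h1 := jacobi_pow_delta_apply a b (⟨y, hy⟩ : Box p n) m ⟨x, hx⟩
        (by simpa using by linarith [abs_nonneg (y - p)])
      simp only at h1
      rw [h1, boxMatrix_pow_apply]
      congr 2
      refine Finset.sum_congr rfl fun k _ => ?_
      have ex : extEigvec a' b' p n k x = boxEigvec a' b' p n k ⟨x, hx⟩ :=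
        boxExtend_coe _ (⟨x, hx⟩ : Box p n)
      have ey : extEigvec a' b' p n k y = boxEigvec a' b' p n k ⟨y, hy⟩ :=
        boxExtend_coe _ (⟨y, hy⟩ : Box p n)
      rw [ex, ey]
    · refine Eventually.of_forall fun n m => ?_
      simp only [c, norm_mul, norm_pow, norm_neg, Complex.norm_I, one_mul, Complex.norm_real,
        norm_inv, Complex.norm_natCast, Real.norm_eq_abs]
      rw [mul_pow, div_eq_inv_mul, mul_assoc]
      gcongr
      exact hPb n m
  rw [← hlim.enorm.liminf_eq]
  exact liminf_le_liminf (Eventually.of_forall hZn)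

/-! ### Resampling one coordinate of a product measure. -/

theorem measurable_update_prod {ι : Type*} [DecidableEq ι] {X : ι → Type*}
    [∀ i, MeasurableSpace (X i)] (i : ι) :
    Measurable fun z : (∀ i, X i) × X i => Function.update z.1 i z.2 := by
  refine measurable_pi_lambda _ fun j => ?_
  by_cases h : j = i
  · subst h; simpa using measurable_snd
  · simpa [Function.update_of_ne h, Function.comp_def] using (measurable_pi_apply j).comp measurable_fst

/-- A product measure is determined by its values on finite-dimensional rectangles, where the new
factor either replaces the old one at i or has total mass one. -/
theorem infinitePi_map_update {ι : Type*} [DecidableEq ι] {X : ι → Type*}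
    [∀ i, MeasurableSpace (X i)] (μ : ∀ i, Measure (X i)) [∀ i, IsProbabilityMeasure (μ i)] (i : ι) :
    ((Measure.infinitePi μ).prod (μ i)).map (fun z => Function.update z.1 i z.2)
      = Measure.infinitePi μ := by
  refine Measure.eq_infinitePi μ fun s t ht => ?_
  have hm := measurable_update_prod (X := X) i
  rw [Measure.map_apply hm (MeasurableSet.pi s.countable_toSet fun j _ => ht j)]
  by_cases hi : i ∈ s
  · have e : (fun z : (∀ i, X i) × X i => Function.update z.1 i z.2) ⁻¹' (s : Set ι).pi t
        = ((s.erase i : Finset ι) : Set ι).pi t ×ˢ t i := by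
      ext ⟨f, x⟩
      simp only [mem_preimage, Set.mem_pi, mem_prod, Finset.mem_coe, Finset.mem_erase]
      constructor
      · intro h
        refine ⟨fun j hj => ?_, ?_⟩
        · simpa [Function.update_of_ne hj.1] using h j hj.2
        · simpa using h i hi
      · rintro ⟨h, h'⟩ j hj
        by_cases hji : j = i
        · subst hji; simpa using h'
        · simpa [Function.update_of_ne hji] using h j ⟨hji, hj⟩
    rw [e, Measure.prod_prod, Measure.infinitePi_pi μ fun j _ => ht j, Finset.prod_erase_mul _ _ hi]
  · have e : (fun z : (∀ i, X i) × X i => Function.update z.1 i z.2) ⁻¹' (s : Set ι).pi t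
        = (s : Set ι).pi t ×ˢ univ := by
      ext ⟨f, x⟩
      simp only [mem_preimage, Set.mem_pi, mem_prod, Finset.mem_coe, mem_univ, and_true]
      refine forall₂_congr fun j hj => ?_
      rw [Function.update_of_ne (ne_of_mem_of_not_mem hj hi)]
    rw [e, Measure.prod_prod, Measure.infinitePi_pi μ fun j _ => ht j, measure_univ, mul_one]

/-- Resampling one coordinate does not change expectations. -/
theorem lintegral_infinitePi_update {ι : Type*} [DecidableEq ι] {X : ι → Type*}
    [∀ i, MeasurableSpace (X i)] (μ : ∀ i, Measure (X i)) [∀ i, IsProbabilityMeasure (μ i)] (i : ι)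
    {F : (∀ i, X i) → ℝ≥0∞} (hF : Measurable F) :
    ∫⁻ ω, F ω ∂Measure.infinitePi μ
      = ∫⁻ ω, ∫⁻ x, F (Function.update ω i x) ∂μ i ∂Measure.infinitePi μ := by
  have hm := measurable_update_prod (X := X) i
  conv_lhs => rw [← infinitePi_map_update μ i, lintegral_map hF hm]
  exact lintegral_prod _ (hF.comp hm).aemeasurable

/-! ### Integrating out the sites one at a time. -/

section

variable {r : ℝ → ℝ} {c : ellInftyZ}

theorem lintegral_siteMeasure_le (hr : Measurable r) (n : ℤ) {f : ℝ → ℝ≥0∞} (hf : Measurable f) :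
    ∫⁻ x, f (x : ℝ) ∂siteMeasure r c n ≤ ∫⁻ x, ENNReal.ofReal (r (x - c n)) * f x := by
  rw [siteMeasure, lintegral_subtype_comap measurableSet_Icc]
  refine (setLIntegral_le_lintegral _ _).trans (le_of_eq ?_)
  rw [lintegral_withDensity_eq_lintegral_mul _ (by fun_prop) hf]
  rfl

/-- The coordinates of a sample point, as a sequence. -/
def coord (ω : SampleSpace r c) (i : ℤ) : ℝ := ω i

theorem measurable_coord (i : ℤ) : Measurable fun ω : SampleSpace r c => coord ω i :=
  measurable_subtype_coe.comp (measurable_pi_apply i)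

theorem coord_update (ω : SampleSpace r c) (i : ℤ) (x : siteInterval r c i) (j : ℤ) :
    coord (Function.update ω i x) j = if j = i then (x : ℝ) else coord ω j := by
  by_cases h : j = i
  · subst h; simp [coord]
  · simp [coord, h]

theorem measurable_contFrac {Ω : Type*} [MeasurableSpace Ω] {α : ℕ → ℝ} {β : Ω → ℕ → ℝ}
    (hβ : ∀ i, Measurable fun ω => β ω i) (k i : ℕ) :
    Measurable fun z : Ω × ℝ => contFrac α (β z.1) z.2 k i := by
  induction k generalizing i with
  | zero => exact measurable_const
  | succ k ih =>
    have h1 : Measurable fun z : Ω × ℝ => β z.1 i := (hβ i).comp measurable_fst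
    exact (measurable_snd.sub h1).sub ((ih (i + 1)).const_div _)

theorem measurable_ksDensity (a : ℤ → ℝ) (p : ℤ) (n m : ℕ) (ε : ℝ) :
    Measurable fun z : SampleSpace r c × ℝ => ksDensity a (coord z.1) p n m ε z.2 := by
  have hR := measurable_contFrac (α := rightOff a p)
    (β := fun ω : SampleSpace r c => rightDiag (coord ω) p) fun i => measurable_coord (p + i)
  have hL := measurable_contFrac (α := leftOff a p)
    (β := fun ω : SampleSpace r c => leftDiag (coord ω) p) fun i => measurable_coord (p - i)
  unfold ksDensity
  refine Measurable.mul ?_ ((measurable_bump ε).comp ?_)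
  · refine Finset.measurable_prod _ fun j _ => ?_
    exact ((hR _ _).abs.const_div _).ennreal_ofReal
  · exact ((measurable_snd.sub ((hR _ _).const_div _)).sub ((hL _ _).const_div _)).sub
      ((measurable_coord p).comp measurable_fst)

/-- The density of the site `p`, after averaging against a bump function. -/
def pivotBound (r : ℝ → ℝ) (κ e s : ℝ) : ℝ≥0∞ :=
  if |e - s| ≤ supportRadius r + 1 then ENNReal.ofReal κ else 0

theorem measurable_pivotBound (κ : ℝ) : Measurable (Function.uncurry (pivotBound r κ)) :=
  Measurable.ite (measurableSet_le (by fun_prop) measurable_const) measurable_const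
    measurable_const

theorem lintegral_bump {ε : ℝ} (hε : 0 < ε) (v : ℝ) : ∫⁻ x, bump ε (v - x) = 1 := by
  rw [lintegral_sub_left_eq_self (bump ε) v]
  have e : bump ε = (Icc (-ε) ε).indicator fun _ => ENNReal.ofReal (2 * ε)⁻¹ := by
    funext x
    simp only [bump, indicator, mem_Icc, abs_le]
  rw [e, lintegral_indicator measurableSet_Icc, setLIntegral_const, Real.volume_Icc,
    ← ENNReal.ofReal_mul (by positivity)]
  rw [show (2 * ε)⁻¹ * (ε - -ε) = 1 by field_simp; ring, ENNReal.ofReal_one]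

/-- The bump has mass one and radius at most 1, so averaging a density bounded by κ gives at most κ,
on a support enlarged by 1. The bound is uniform in ε. -/
theorem lintegral_density_mul_bump_le {κ ε : ℝ} (hs : HasCompactSupport r) (hκ : ∀ x, r x ≤ κ)
    (hε : 0 < ε) (hε1 : ε ≤ 1) (v e : ℝ) :
    ∫⁻ x, ENNReal.ofReal (r (x - e)) * bump ε (v - x) ≤ pivotBound r κ v e := by
  rw [pivotBound]
  split_ifs with h
  · calc ∫⁻ x, ENNReal.ofReal (r (x - e)) * bump ε (v - x)
        ≤ ∫⁻ x, ENNReal.ofReal κ * bump ε (v - x) := by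
          gcongr with x
          exact hκ _
      _ = ENNReal.ofReal κ := by
          have m : Measurable fun x => bump ε (v - x) := (measurable_bump ε).comp (by fun_prop)
          rw [lintegral_const_mul _ m, lintegral_bump hε, mul_one]
  · refine (lintegral_eq_zero_of_ae_eq_zero (Eventually.of_forall fun x => ?_)).le
    by_contra hne
    simp only [Pi.zero_apply, mul_eq_zero, not_or] at hne
    have h1 : |x - e| ≤ supportRadius r :=
      abs_le_supportRadius hs fun h0 => hne.1 (by rw [h0, ENNReal.ofReal_zero])
    have h2 : |v - x| ≤ ε := by
      by_contra h2
      exact hne.2 (if_neg h2)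
    refine h ((abs_sub_le v x e).trans ?_)
    linarith

theorem sqNorm_pivotBound (κ e : ℝ) (hκ : 0 ≤ κ) :
    sqNorm (pivotBound r κ e) ≤ ENNReal.ofReal (κ ^ 2 * (2 * (supportRadius r + 1))) := by
  have h : ∀ s, pivotBound r κ e s ^ 2
      = (Icc (e - (supportRadius r + 1)) (e + (supportRadius r + 1))).indicator
        (fun _ => ENNReal.ofReal (κ ^ 2)) s := by
    intro s
    simp only [pivotBound, indicator, mem_Icc, abs_le, ENNReal.ofReal_pow hκ]
    split_ifs with h1 h2 h2
    · rfl
    · exact absurd ⟨by linarith [h1.2], by linarith [h1.1]⟩ h2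
    · exact absurd ⟨by linarith [h2.2], by linarith [h2.1]⟩ h1
    · simp
  simp only [sqNorm, h]
  rw [lintegral_indicator measurableSet_Icc, setLIntegral_const, Real.volume_Icc,
    ← ENNReal.ofReal_mul (by positivity)]
  refine ENNReal.ofReal_le_ofReal (le_of_eq ?_)
  ring

/-- The density after averaging over the sites `p, …, p + k`. -/
def partialAvg (a : ℤ → ℝ) (p : ℤ) (n m : ℕ) (κ E : ℝ) (k : ℕ) (ω : SampleSpace r c) : ℝ≥0∞ :=
  (∏ j ∈ Finset.Ico k m, ENNReal.ofReal
    (rightOff a p j / |contFrac (rightOff a p) (rightDiag (coord ω) p) E (n - j) (j + 1)|)) *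
  ksIter r (rightDiag c p) (rightOff a p) E
    (pivotBound r κ (E - leftOff a p 0 ^ 2 /
      contFrac (leftOff a p) (leftDiag (coord ω) p) E n 1 - c p)) k
    (rightOff a p k ^ 2 / contFrac (rightOff a p) (rightDiag (coord ω) p) E (n - k) (k + 1))

theorem measurable_partialAvg (hr : Measurable r) (a : ℤ → ℝ) (p : ℤ) (n m : ℕ) (κ E : ℝ) (k : ℕ) :
    Measurable (partialAvg (r := r) (c := c) a p n m κ E k) := by
  have hE : Measurable fun ω : SampleSpace r c => (ω, E) := by fun_prop
  have hR : ∀ k i, Measurable fun ω : SampleSpace r c =>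
      contFrac (rightOff a p) (rightDiag (coord ω) p) E k i := fun k i =>
    (measurable_contFrac (α := rightOff a p)
      (β := fun ω : SampleSpace r c => rightDiag (coord ω) p) (fun i => measurable_coord (p + i))
      k i).comp hE
  have hL : ∀ k i, Measurable fun ω : SampleSpace r c =>
      contFrac (leftOff a p) (leftDiag (coord ω) p) E k i := fun k i =>
    (measurable_contFrac (α := leftOff a p)
      (β := fun ω : SampleSpace r c => leftDiag (coord ω) p) (fun i => measurable_coord (p - i))
      k i).comp hE
  unfold partialAvg
  refine Measurable.mul ?_ ?_
  · refine Finset.measurable_prod _ fun j _ => ?_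
    exact ((hR _ _).abs.const_div _).ennreal_ofReal
  · exact (measurable_ksIter_uncurry (c := rightDiag c p) (α := rightOff a p) (E := E) hr
      (measurable_pivotBound (r := r) κ) k).comp
      (((measurable_const.sub ((hL n 1).const_div _)).sub measurable_const).prodMk
        ((hR _ _).const_div _))

/-- In the site variable x at p + k + 1, the level-k continued fraction is E - x - s, with s
determined by later sites. Its weight α_k/|E - x - s| and the argument α_k²/(E - x - s) of the
recursion together form the inversion, so the integral over x is the next step. The remaining
factors and the left half do not see x. -/
theorem lintegral_partialAvg_update_le (hr : Measurable r) (a : ℤ → ℝ) (p : ℤ) {n m : ℕ}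
    (hm : m ≤ n) (κ E : ℝ) {k : ℕ} (hk : k < m) (ω : SampleSpace r c) :
    ∫⁻ x, partialAvg a p n m κ E k (Function.update ω (p + (k + 1 : ℕ)) x)
        ∂siteMeasure r c (p + (k + 1 : ℕ))
      ≤ partialAvg a p n m κ E (k + 1) ω := by
  have hd : ∀ (x : siteInterval r c (p + (k + 1 : ℕ))) (j : ℕ), k + 2 ≤ j →
      rightDiag (coord (Function.update ω (p + (k + 1 : ℕ)) x)) p j = rightDiag (coord ω) p j := by
    intro x j hj
    rw [rightDiag, coord_update, if_neg (by omega), rightDiag]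
  have hl : ∀ x : siteInterval r c (p + (k + 1 : ℕ)),
      leftDiag (coord (Function.update ω (p + (k + 1 : ℕ)) x)) p = leftDiag (coord ω) p := by
    intro x
    funext j
    rw [leftDiag, coord_update, if_neg (by omega), leftDiag]
  set G := ksIter r (rightDiag c p) (rightOff a p) E
    (pivotBound r κ (E - leftOff a p 0 ^ 2 /
      contFrac (leftOff a p) (leftDiag (coord ω) p) E n 1 - c p)) with hG
  set s := rightOff a p (k + 1) ^ 2 /
    contFrac (rightOff a p) (rightDiag (coord ω) p) E (n - (k + 1)) (k + 1 + 1) with hs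
  set P := ∏ j ∈ Finset.Ico (k + 1) m, ENNReal.ofReal
    (rightOff a p j / |contFrac (rightOff a p) (rightDiag (coord ω) p) E (n - j) (j + 1)|) with hP
  have h : ∀ x : siteInterval r c (p + (k + 1 : ℕ)),
      partialAvg a p n m κ E k (Function.update ω (p + (k + 1 : ℕ)) x)
        = P * inversion (rightOff a p k) (G k) (E - x - s) := by
    intro x
    have ht : contFrac (rightOff a p)
        (rightDiag (coord (Function.update ω (p + (k + 1 : ℕ)) x)) p) E (n - k) (k + 1)
        = E - x - s := by
      rw [show n - k = n - (k + 1) + 1 by omega, contFrac, contFrac_congr (hd x), ← hs]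
      rw [rightDiag, coord_update, if_pos rfl]
    rw [partialAvg, hl, ← hG, ht, Finset.prod_eq_prod_Ico_succ_bot hk, ht, inversion]
    have hP' : ∏ j ∈ Finset.Ico (k + 1) m, ENNReal.ofReal (rightOff a p j /
        |contFrac (rightOff a p) (rightDiag (coord (Function.update ω (p + (k + 1 : ℕ)) x)) p) E
          (n - j) (j + 1)|) = P := by
      refine Finset.prod_congr rfl fun j hj => ?_
      have hj' := (Finset.mem_Ico.1 hj).1
      rw [contFrac_congr fun i hi => hd x i (by omega)]
    rw [hP']
    ring
  have mG : Measurable (G k) := measurable_ksIter hr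
    ((measurable_pivotBound (r := r) κ).comp measurable_prodMk_left) k
  have mI : Measurable fun x : ℝ => inversion (rightOff a p k) (G k) (E - x - s) :=
    (measurable_inversion _ mG).comp (by fun_prop)
  simp only [h]
  refine (lintegral_const_mul P (mI.comp measurable_subtype_coe)).le.trans ?_
  rw [partialAvg, ← hG, ← hs, ← hP]
  gcongr
  exact lintegral_siteMeasure_le hr _ mI

/-- The variable b(p) enters only through the bump. Its average, as a function of the right-hand
continued-fraction term s, starts the recursion. -/
theorem lintegral_ksDensity_update_le (hr : Measurable r) (hsupp : HasCompactSupport r) {κ : ℝ}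
    (hκ : ∀ x, r x ≤ κ) (a : ℤ → ℝ) (p : ℤ) (n m : ℕ) {ε : ℝ} (hε : 0 < ε) (hε1 : ε ≤ 1) (E : ℝ)
    (ω : SampleSpace r c) :
    ∫⁻ x, ksDensity a (coord (Function.update ω p x)) p n m ε E ∂siteMeasure r c p
      ≤ partialAvg a p n m κ E 0 ω := by
  have hd : ∀ (x : siteInterval r c p) (j : ℕ), 1 ≤ j →
      rightDiag (coord (Function.update ω p x)) p j = rightDiag (coord ω) p j := by
    intro x j hj
    rw [rightDiag, coord_update, if_neg (by omega), rightDiag]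
  have hl : ∀ (x : siteInterval r c p) (j : ℕ), 1 ≤ j →
      leftDiag (coord (Function.update ω p x)) p j = leftDiag (coord ω) p j := by
    intro x j hj
    rw [leftDiag, coord_update, if_neg (by omega), leftDiag]
  set s := rightOff a p 0 ^ 2 / contFrac (rightOff a p) (rightDiag (coord ω) p) E n 1 with hs
  set y := leftOff a p 0 ^ 2 / contFrac (leftOff a p) (leftDiag (coord ω) p) E n 1 with hy
  set P := ∏ j ∈ Finset.range m, ENNReal.ofReal
    (rightOff a p j / |contFrac (rightOff a p) (rightDiag (coord ω) p) E (n - j) (j + 1)|) with hP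
  have h : ∀ x : siteInterval r c p, ksDensity a (coord (Function.update ω p x)) p n m ε E
      = P * bump ε (E - s - y - x) := by
    intro x
    rw [ksDensity, contFrac_congr (hd x), contFrac_congr (hl x), ← hs, ← hy, coord_update,
      if_pos rfl]
    congr 1
    refine Finset.prod_congr rfl fun j hj => ?_
    rw [contFrac_congr fun i hi => hd x i (by omega)]
  have mB : Measurable fun x : ℝ => bump ε (E - s - y - x) :=
    (measurable_bump ε).comp (by fun_prop)
  simp only [h]
  refine (lintegral_const_mul P (mB.comp measurable_subtype_coe)).le.trans ?_
  rw [partialAvg, ← Finset.range_eq_Ico, ← hP, ← hy]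
  gcongr
  refine (lintegral_siteMeasure_le hr _ mB).trans
    ((lintegral_density_mul_bump_le hsupp hκ hε hε1 _ _).trans (le_of_eq ?_))
  change pivotBound r κ (E - s - y) (c p) = pivotBound r κ (E - y - c p) s
  rw [pivotBound, pivotBound, show E - s - y - c p = E - y - c p - s by ring]

end

/-! ### Measurability of the maximal amplitude. -/

section Measurability

variable (r : ℝ → ℝ) (a c : ellInftyZ)

theorem measurable_randomJacobi_pow_delta (m : ℕ) (x y : ℤ) :
    Measurable fun ω : SampleSpace r c => (randomJacobi r a c ω ^ m) (delta y) x := by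
  induction m generalizing x with
  | zero => exact measurable_const
  | succ m ih =>
    have h : ∀ ω : SampleSpace r c, (randomJacobi r a c ω ^ (m + 1)) (delta y) x
        = a x * (randomJacobi r a c ω ^ m) (delta y) (x + 1)
          + a (x - 1) * (randomJacobi r a c ω ^ m) (delta y) (x - 1)
          + (coord ω x : ℂ) * (randomJacobi r a c ω ^ m) (delta y) x := by
      intro ω
      rw [pow_succ', mul_apply_eq_comp]
      exact jacobi_apply _ _ _ _
    simp only [h]
    have hc : Measurable fun ω : SampleSpace r c => (coord ω x : ℂ) :=
      Complex.measurable_ofReal.comp (measurable_coord x)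
    have comb : ∀ {f g h : SampleSpace r c → ℂ}, Measurable f → Measurable g → Measurable h →
        Measurable fun ω => (a x : ℂ) * f ω + a (x - 1) * g ω + (coord ω x : ℂ) * h ω :=
      fun hf hg hh => ((hf.const_mul _).add (hg.const_mul _)).add (hc.mul hh)
    exact comb (ih _) (ih _) (ih _)

theorem measurable_inner_evolution (t : ℝ) (x y : ℤ) :
    Measurable fun ω : SampleSpace r c =>
      inner ℂ (delta x) (evolution (randomJacobi r a c ω) t (delta y)) := by
  refine measurable_of_tendsto_metrizable (f := fun N ω => ∑ m ∈ Finset.range N,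
    ((m.factorial : ℂ)⁻¹ * (-(Complex.I * t)) ^ m) * (randomJacobi r a c ω ^ m) (delta y) x) ?_ ?_
  · intro N
    exact Finset.measurable_sum _ fun m _ =>
      (measurable_randomJacobi_pow_delta r a c m x y).const_mul _
  · exact tendsto_pi_nhds.2 fun ω =>
      (hasSum_evolution_delta (randomJacobi r a c ω) t x y).tendsto_sum_nat

theorem continuous_inner_evolution (J : ell2Z →L[ℂ] ell2Z) (x y : ℤ) :
    Continuous fun t : ℝ => inner ℂ (delta x) (evolution J t (delta y)) := by
  have h : Continuous fun t : ℝ => evolution J t := by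
    unfold evolution
    let _ : NormedAlgebra ℚ (ell2Z →L[ℂ] ell2Z) := NormedAlgebra.restrictScalars ℚ ℂ _
    exact NormedSpace.exp_continuous.comp (by fun_prop)
  fun_prop

/-- Continuity in t reduces the supremum to rational times. -/
theorem measurable_maxAmplitude (x y : ℤ) : Measurable (maxAmplitude r a c x y) := by
  have h : maxAmplitude r a c x y = fun ω => ⨆ q : ℚ,
      ‖inner ℂ (delta x) (evolution (randomJacobi r a c ω) (q : ℝ) (delta y))‖ₑ := by
    funext ω
    refine le_antisymm (iSup_le fun t => ?_) (iSup_le fun q => le_iSup_of_le (q : ℝ) le_rfl)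
    refine DenseRange.induction_on (p := fun t : ℝ =>
      ‖inner ℂ (delta x) (evolution (randomJacobi r a c ω) t (delta y))‖ₑ ≤ _)
      (Rat.denseRange_cast (𝕜 := ℝ)) t ?_ ?_
    · exact isClosed_le (continuous_inner_evolution _ x y).enorm continuous_const
    · exact fun q => le_iSup (fun q : ℚ =>
        ‖inner ℂ (delta x) (evolution (randomJacobi r a c ω) (q : ℝ) (delta y))‖ₑ) q
  rw [h]
  exact Measurable.iSup fun q => (measurable_inner_evolution r a c q x y).enorm

end Measurability

/-! ### The averaged bound and the conclusion. -/

section Averages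

variable {r : ℝ → ℝ} {c : ellInftyZ}

theorem lintegral_ksDensity_le_lintegral_partialAvg (hr : Measurable r)
    (hsupp : HasCompactSupport r) {κ : ℝ} (hκ : ∀ x, r x ≤ κ)
    [∀ n, IsProbabilityMeasure (siteMeasure r c n)] (a : ℤ → ℝ) (p : ℤ) {n m : ℕ} (hm : m ≤ n)
    {ε : ℝ} (hε : 0 < ε) (hε1 : ε ≤ 1) (E : ℝ) {k : ℕ} (hk : k ≤ m) :
    ∫⁻ ω, ksDensity a (coord ω) p n m ε E ∂sampleMeasure r c
      ≤ ∫⁻ ω, partialAvg a p n m κ E k ω ∂sampleMeasure r c := by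
  induction k with
  | zero =>
    have mF : Measurable fun ω : SampleSpace r c => ksDensity a (coord ω) p n m ε E :=
      Measurable.comp (g := fun z : SampleSpace r c × ℝ => ksDensity a (coord z.1) p n m ε z.2)
        (f := fun ω => (ω, E)) (measurable_ksDensity a p n m ε)
        (measurable_id.prodMk measurable_const)
    rw [sampleMeasure, lintegral_infinitePi_update _ p mF]
    exact lintegral_mono fun ω => lintegral_ksDensity_update_le hr hsupp hκ a p n m hε hε1 E ω
  | succ k ih =>
    refine (ih (by omega)).trans ?_
    rw [sampleMeasure, lintegral_infinitePi_update _ (p + (k + 1 : ℕ))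
      (measurable_partialAvg hr a p n m κ E k)]
    exact lintegral_mono fun ω => lintegral_partialAvg_update_le hr a p hm κ E (by omega) ω

end Averages

/-- Exponential dynamical localization, uniformly in the position of the two sites. -/
theorem exists_lintegral_maxAmplitude_le {r : ℝ → ℝ} (hr0 : ∀ x, 0 ≤ r x) (hr : Measurable r)
    {κ : ℝ} (hκ : ∀ x, r x ≤ κ) (hsupp : HasCompactSupport r) (hr1 : ∫ x, r x = 1)
    (a c : ellInftyZ) (ha : ∀ n : ℤ, 0 < a n) :
    ∃ C γ : ℝ, 0 < C ∧ 0 < γ ∧ ∀ (p : ℤ) (m : ℕ) (x y : ℤ),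
      (x = p ∧ y = p + m ∨ x = p + m ∧ y = p) →
      ∫⁻ ω, maxAmplitude r a c x y ω ∂sampleMeasure r c
        ≤ ENNReal.ofReal (C * Real.exp (-γ * m)) := by
  have hprob : ∀ n, IsProbabilityMeasure (siteMeasure r c n) :=
    isProbabilityMeasure_siteMeasure hr0 hsupp hr1 c
  have hκ0 : 0 < κ := by
    by_contra! h
    have : ∀ x, r x = 0 := fun x => le_antisymm ((hκ x).trans h) (hr0 x)
    simp [this] at hr1
  have hA : 0 < ‖a‖ := (ha 0).trans_le ((le_abs_self _).trans (abs_le_norm a 0))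
  obtain ⟨C, γ, hC, hγ, hiter⟩ := exists_ksIter_le hr hr0 hr1
    (B := κ ^ 2 * (2 * (supportRadius r + 1))) hκ0 hκ hA
  have hM : 0 ≤ supportRadius r := by
    obtain ⟨x, hx⟩ : ∃ x, r x ≠ 0 := by
      by_contra! h
      simp [h] at hr1
    exact (abs_nonneg x).trans (abs_le_supportRadius hsupp hx)
  -- A common bound for the spectra of all boxes and all samples, with 1 added to make it strict.
  -- The length 2R of the energy window enters the final constant.
  set R : ℝ := 2 * ‖a‖ + (‖c‖ + supportRadius r) + 1 with hR
  have hR0 : 0 < R := by positivity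
  refine ⟨C * (2 * R), γ, by positivity, hγ, fun p m x y hxy => ?_⟩
  have hsite : ∀ n m : ℕ, m ≤ n → ∀ ε, 0 < ε → ε ≤ 1 → ∀ E,
      ∫⁻ ω, ksDensity a (coord ω) p n m ε E ∂sampleMeasure r c
        ≤ ENNReal.ofReal (C * Real.exp (-γ * m)) := by
    intro n m hm ε hε hε1 E
    have : IsProbabilityMeasure (sampleMeasure r c) := by
      unfold sampleMeasure; infer_instance
    refine (lintegral_ksDensity_le_lintegral_partialAvg hr hsupp hκ a p hm hε hε1 E le_rfl).trans ?_
    calc ∫⁻ ω, partialAvg a p n m κ E m ω ∂sampleMeasure r c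
        ≤ ∫⁻ _, ENNReal.ofReal (C * Real.exp (-γ * m)) ∂sampleMeasure r c := by
          refine lintegral_mono fun ω => ?_
          rw [partialAvg, Finset.Ico_self, Finset.prod_empty, one_mul]
          refine hiter _ _ _ _ (fun k => ha _)
            (fun k => (le_abs_self _).trans (abs_le_norm a _))
            ((measurable_pivotBound κ).comp measurable_prodMk_left) (fun s => ?_)
            (sqNorm_pivotBound κ _ hκ0.le) m _
          simp only [Function.comp_apply, Function.uncurry_apply_pair, pivotBound]
          split_ifs
          · exact le_rfl
          · exact zero_le
      _ = _ := by rw [lintegral_const, measure_univ, mul_one]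
  -- The box radius is n and the bump width parameter is 1/(j + 1) ≤ 1. For fixed n, j tends to
  -- infinity first; Fatou's lemma is applied to each limit.
  set W : ℕ → ℕ → SampleSpace r c → ℝ≥0∞ := fun n j ω =>
    ∫⁻ E in Icc (-R) R, ksDensity a (coord ω) p n m (1 / ((j : ℝ) + 1)) E
  have mW : ∀ n j, Measurable (W n j) := fun n j =>
    (measurable_ksDensity a p n m _).lintegral_prod_right'
  have hW : ∀ n, m ≤ n → ∀ j,
      ∫⁻ ω, W n j ω ∂sampleMeasure r c ≤ ENNReal.ofReal (C * (2 * R) * Real.exp (-γ * m)) := by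
    intro n hn j
    have : IsProbabilityMeasure (sampleMeasure r c) := by
      unfold sampleMeasure; infer_instance
    have hj : (0 : ℝ) < (j : ℝ) + 1 := by positivity
    simp only [W]
    rw [lintegral_lintegral_swap (measurable_ksDensity a p n m _).aemeasurable]
    calc _ ≤ ∫⁻ _ in Icc (-R) R, ENNReal.ofReal (C * Real.exp (-γ * m)) :=
          lintegral_mono fun E => hsite n m hn _ (by positivity)
            ((div_le_one hj).2 (by linarith [(Nat.cast_nonneg j : (0 : ℝ) ≤ j)])) E
      _ = _ := by
          rw [setLIntegral_const, Real.volume_Icc, ← ENNReal.ofReal_mul (by positivity)]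
          congr 1
          ring
  have hmax : ∀ ω, maxAmplitude r a c x y ω
      ≤ liminf (fun n => liminf (fun j => W n j ω) atTop) atTop := by
    intro ω
    refine iSup_le fun t => (enorm_inner_evolution_le a (potential r c ω) p x y t).trans ?_
    refine liminf_le_liminf ?_
    filter_upwards [eventually_ge_atTop m] with n hn
    have hb : ∀ i, |coord ω i| ≤ ‖c‖ + supportRadius r := by
      intro i
      have h : c i - supportRadius r ≤ coord ω i ∧ coord ω i ≤ c i + supportRadius r := (ω i).2
      have hc := abs_le.1 (abs_le_norm c i)
      exact abs_le.2 ⟨by linarith [h.1, hc.1], by linarith [h.2, hc.2]⟩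
    have hmem : p + (m : ℤ) ∈ Finset.Icc (p - n : ℤ) (p + n) := by
      rw [Finset.mem_Icc]; omega
    have h := boxCorrelator_le_liminf (a := a) (b := coord ω) ha hn (R := R)
      (fun k => (abs_boxEigval_le a (coord ω) p n (abs_le_norm a) hb k).trans_lt (by linarith))
      (x := ⟨p + m, hmem⟩) rfl (ε := fun j => 1 / ((j : ℝ) + 1)) (fun j => by positivity)
      tendsto_one_div_add_atTop_nhds_zero_nat
    rw [← extCorrelator_coe] at h
    rcases hxy with ⟨rfl, rfl⟩ | ⟨rfl, rfl⟩
    · exact h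
    · rw [extCorrelator_comm]
      exact h
  calc ∫⁻ ω, maxAmplitude r a c x y ω ∂sampleMeasure r c
      ≤ ∫⁻ ω, liminf (fun n => liminf (fun j => W n j ω) atTop) atTop ∂sampleMeasure r c :=
        lintegral_mono hmax
    _ ≤ liminf (fun n => ∫⁻ ω, liminf (fun j => W n j ω) atTop ∂sampleMeasure r c) atTop :=
        lintegral_liminf_le fun n => Measurable.liminf fun j => mW n j
    _ ≤ ENNReal.ofReal (C * (2 * R) * Real.exp (-γ * m)) := by
        refine liminf_le_of_le (by isBoundedDefault) fun v hv => ?_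
        obtain ⟨n, hn, hnm⟩ := (hv.and (eventually_ge_atTop m)).exists
        refine hn.trans ((lintegral_liminf_le fun j => mW n j).trans ?_)
        refine liminf_le_of_le (by isBoundedDefault) fun v hv => ?_
        obtain ⟨j, hj⟩ := hv.exists
        exact hj.trans (hW n hnm j)

end

end RandomJacobi

theorem theorem2p1
    (r : ℝ → ℝ) (hr_nonneg : ∀ x, 0 ≤ r x) (hr_meas : Measurable r)
    (hr_bdd : ∃ K : ℝ, ∀ x, r x ≤ K) (hr_supp : HasCompactSupport r)
    (hr_norm : ∫ x, r x = 1)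
    (a c : RandomJacobi.ellInftyZ) (δ : ℝ) (hδ : 0 < δ) (ha : ∀ n : ℤ, δ ≤ a n) :
    ∃ C γ : ℝ, 0 < C ∧ 0 < γ ∧ ∀ m : ℤ,
      Measurable (RandomJacobi.maxAmplitude r a c m 0) ∧
      ∫⁻ ω, RandomJacobi.maxAmplitude r a c m 0 ω ∂(RandomJacobi.sampleMeasure r c)
        ≤ ENNReal.ofReal (C * Real.exp (-γ * |(m : ℝ)|)) := by
  obtain ⟨K, hK⟩ := hr_bdd
  obtain ⟨C, γ, hC, hγ, h⟩ := RandomJacobi.exists_lintegral_maxAmplitude_le hr_nonneg hr_meas hK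
    hr_supp hr_norm a c fun n => hδ.trans_le (ha n)
  refine ⟨C, γ, hC, hγ, fun m => ⟨RandomJacobi.measurable_maxAmplitude r a c m 0, ?_⟩⟩
  have hcast : |(m : ℝ)| = (m.natAbs : ℝ) := by rw [Nat.cast_natAbs, Int.cast_abs]
  rw [hcast]
  -- The pivot is the left one of the sites 0 and m, since the averaging runs to the right from p.
  rcases le_total 0 m with hm | hm
  · exact h 0 m.natAbs m 0 (Or.inr ⟨by omega, rfl⟩)
  · exact h m m.natAbs m 0 (Or.inl ⟨rfl, by omega⟩)
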